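/- Let $d\ge 2$ and let $\mathcal{O}_d$ be the Cuntz algebra, i.e. the universal unital $C^*$-algebra generated by elements $s_1,\dots,s_d$ subject to the relations $s_i^*s_j=\delta_{ij}1$ and $\sum_{i=1}^d s_is_i^*=1$. Let $L_1,\dots,L_d$ be integers and let $\sigma=(\sigma_t)_{t\in\mathbb{R}}$ be the periodic one-parameter group of $*$-automorphisms of $\mathcal{O}_d$ determined by $$\sigma_t(s_j)=e^{itL_j}s_j,\qquad j=1,\dots,d.$$ Let $\mathfrak{A}_L=\{x\in\mathcal{O}_d : \sigma_t(x)=x \text{ for all } t\in\mathbb{R}\}$ be its fixed-point algebra. Then the following conditions are equivalent. 1. $\mathfrak{A}_L$ is an AF-algebra, i.e. it is the closure of the union of an increasing sequence of finite-dimensional $*$-subalgebras. 2. All the $L_i$ have the same sign and none is zero: either $L_i>0$ for all $i$, or $L_i<0$ for all $i$. 3. There is a $\beta\in\mathbb{R}$ such that $\mathcal{O}_d$ admits a $(\sigma,\beta)$-KMS state, i.e. a state $\omega$ such that $\omega(x\,\sigma_{i\beta}(y))=\omega(yx)$ for all $x,y$ in some norm-dense $\sigma$-invariant $*$-subalgebra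 consisting of elements $y$ for which $t\mapsto\sigma_t(y)$ extends to an entire function $z\mapsto\sigma_z(y)$. Furthermore, if these conditions are not fulfilled, then $\mathfrak{A}_L$ contains an isometry which is not unitary. -/

import Mathlib

open scoped ENNReal ComplexOrder CStarAlgebra

noncomputable section

/-- The Cuntz relations for a `d`-tuple `s` in a unital star algebra:
`sᵢ* sⱼ = δᵢⱼ 1` and `∑ᵢ sᵢ sᵢ* = 1`. -/
structure IsCuntzFamily {d : ℕ} {A : Type*} [Ring A] [Star A] (s : Fin d → A) : Prop where
  star_mul : ∀ i j, star (s i) * s j = if i = j then 1 else 0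
  sum_mul_star : ∑ i, s i * star (s i) = 1

/-- A realization of the Cuntz relations in some nonzero unital C⋆-algebra. A C⋆-algebra generated
by finitely many elements is separable, hence has at most the cardinality of the continuum, so
the realizations in C⋆-algebras in `Type` are all realizations up to isomorphism. -/
structure CuntzRealization (d : ℕ) where
  /-- the C⋆-algebra -/
  carrier : Type
  [cstar : CStarAlgebra carrier]
  [nontriv : Nontrivial carrier]
  /-- the generators -/
  gen : Fin d → carrier
  isCuntz : IsCuntzFamily gen

attribute [instance] CuntzRealization.cstar CuntzRealization.nontriv

/-- The `ℓ^∞`-product of all realizations of the Cuntz relations. -/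
abbrev CuntzProduct (d : ℕ) : Type 1 := lp (fun r : CuntzRealization d => r.carrier) ∞

/-- The pointwise operations and the supremum norm make the product a C⋆-algebra. -/
instance instCStarAlgebraCuntzProduct (d : ℕ) : CStarAlgebra (CuntzProduct d) where

/-- A member of a Cuntz family is a contraction. -/
theorem IsCuntzFamily.norm_le_one {d : ℕ} {A : Type*} [CStarAlgebra A] [Nontrivial A]
    {s : Fin d → A} (hs : IsCuntzFamily s) (i : Fin d) : ‖s i‖ ≤ 1 := by
  have h := hs.star_mul i i
  have h2 := CStarRing.norm_star_mul_self (x := s i)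
  rw [h, if_pos rfl, norm_one] at h2
  nlinarith [norm_nonneg (s i)]

/-- The tuple of `i`-th generators of all the realizations. -/
def cuntzProductGen (d : ℕ) (i : Fin d) : CuntzProduct d :=
  ⟨fun r => r.gen i, memℓp_infty ⟨1, by
    rintro _ ⟨r, rfl⟩
    exact r.isCuntz.norm_le_one i⟩⟩

/-- The star subalgebra underlying the Cuntz algebra. -/
def cuntzSubalgebra (d : ℕ) : StarSubalgebra ℂ (CuntzProduct d) :=
  (StarAlgebra.adjoin ℂ (Set.range (cuntzProductGen d))).topologicalClosure

/-- The Cuntz algebra `𝒪_d`: the universal unital C⋆-algebra on generators subject to the Cuntz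
relations, realized as the C⋆-algebra generated by the universal family in the product of all
realizations. -/
abbrev CuntzAlgebra (d : ℕ) : Type 1 := cuntzSubalgebra d

instance instIsClosedCuntzSubalgebra (d : ℕ) :
    IsClosed (cuntzSubalgebra d : Set (CuntzProduct d)) :=
  StarSubalgebra.isClosed_topologicalClosure _

instance instCStarAlgebraCuntzAlgebra (d : ℕ) : CStarAlgebra (CuntzAlgebra d) :=
  StarSubalgebra.cstarAlgebra (cuntzSubalgebra d)

namespace CuntzAlgebra

/-- The canonical generators `s_1, …, s_d` of `𝒪_d`. -/
def gen (d : ℕ) (i : Fin d) : CuntzAlgebra d :=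
  ⟨cuntzProductGen d i, StarSubalgebra.le_topologicalClosure _
    (StarAlgebra.subset_adjoin ℂ _ ⟨i, rfl⟩)⟩

theorem isCuntzFamily_gen (d : ℕ) : IsCuntzFamily (gen d) where
  star_mul i j := by
    apply Subtype.ext
    apply lp.ext
    funext r
    have h := r.isCuntz.star_mul i j
    split_ifs with hij
    · rw [if_pos hij] at h; exact h
    · rw [if_neg hij] at h; exact h
  sum_mul_star := by
    apply Subtype.ext
    apply lp.ext
    funext r
    have h := r.isCuntz.sum_mul_star
    rw [AddSubmonoidClass.coe_finsetSum, lp.coeFn_sum, Finset.sum_apply]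
    exact h

/-- The universal property of `𝒪_d`: any realization of the Cuntz relations is the image
of the canonical generators under a star homomorphism. -/
theorem exists_lift (d : ℕ) {A : Type} [CStarAlgebra A] [Nontrivial A] {s : Fin d → A}
    (hs : IsCuntzFamily s) : ∃ φ : CuntzAlgebra d →⋆ₐ[ℂ] A, ∀ i, φ (gen d i) = s i :=
  ⟨{ toFun := fun x => x.1 ⟨A, s, hs⟩
     map_one' := rfl
     map_mul' := fun _ _ => rfl
     map_zero' := rfl
     map_add' := fun _ _ => rfl
     commutes' := fun _ => rfl
     map_star' := fun _ => rfl }, fun _ => rfl⟩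

/-- Multiplication of the generators of a realization by phases. -/
def twist {d : ℕ} (z : Fin d → Circle) (r : CuntzRealization d) : CuntzRealization d where
  carrier := r.carrier
  gen i := (z i : ℂ) • r.gen i
  isCuntz :=
    { star_mul := fun i j => by
        have h := r.isCuntz.star_mul i j
        have hz : star (z i : ℂ) * (z i : ℂ) = 1 := by
          simp [← Complex.normSq_eq_conj_mul_self]
        simp only [star_smul, smul_mul_smul_comm, h]
        split_ifs with hij
        · subst hij; rw [hz, one_smul]
        · simp
      sum_mul_star := by
        have h := r.isCuntz.sum_mul_star
        have hz : ∀ i, (z i : ℂ) * star (z i : ℂ) = 1 := fun i => by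
          simp [Complex.mul_conj]
        simp only [star_smul, smul_mul_smul_comm, hz, one_smul, h] }

/-- Permuting the realizations by `twist z` gives an endomorphism of their product. -/
def productTwist {d : ℕ} (z : Fin d → Circle) : CuntzProduct d →⋆ₐ[ℂ] CuntzProduct d where
  toFun x := ⟨fun r => x (twist z r), memℓp_infty (by
    obtain ⟨C, hC⟩ := memℓp_infty_iff.1 x.2
    refine ⟨C, ?_⟩
    rintro _ ⟨r, rfl⟩
    exact hC ⟨twist z r, rfl⟩)⟩
  map_one' := rfl
  map_mul' _ _ := rfl
  map_zero' := rfl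
  map_add' _ _ := rfl
  commutes' _ := rfl
  map_star' _ := rfl

theorem productTwist_gen {d : ℕ} (z : Fin d → Circle) (i : Fin d) :
    productTwist z (cuntzProductGen d i) = (z i : ℂ) • cuntzProductGen d i := rfl

theorem productTwist_mem {d : ℕ} (z : Fin d → Circle) {x : CuntzProduct d}
    (hx : x ∈ cuntzSubalgebra d) : productTwist z x ∈ cuntzSubalgebra d := by
  have h : cuntzSubalgebra d ≤ (cuntzSubalgebra d).comap (productTwist z) := by
    refine StarSubalgebra.topologicalClosure_minimal ?_ ?_
    · refine StarAlgebra.adjoin_le ?_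
      rintro _ ⟨i, rfl⟩
      change productTwist z (cuntzProductGen d i) ∈ cuntzSubalgebra d
      rw [productTwist_gen]
      exact SMulMemClass.smul_mem _ (gen d i).2
    · exact (instIsClosedCuntzSubalgebra d).preimage (map_continuous (productTwist z))
  exact h hx

/-- The endomorphism of `𝒪_d` with `sᵢ ↦ zᵢ sᵢ`. -/
def gaugeHom {d : ℕ} (z : Fin d → Circle) : CuntzAlgebra d →⋆ₐ[ℂ] CuntzAlgebra d :=
  ((productTwist z).comp (cuntzSubalgebra d).subtype).codRestrict (cuntzSubalgebra d)
    fun x => productTwist_mem z x.2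

theorem gaugeHom_gen {d : ℕ} (z : Fin d → Circle) (i : Fin d) :
    gaugeHom z (gen d i) = (z i : ℂ) • gen d i := rfl

/-- A star homomorphism on `𝒪_d` is determined by the images of the generators. -/
theorem hom_ext {d : ℕ} {A : Type*} [CStarAlgebra A] {φ ψ : CuntzAlgebra d →⋆ₐ[ℂ] A}
    (h : ∀ i, φ (gen d i) = ψ (gen d i)) : φ = ψ := by
  refine StarAlgHom.ext_topologicalClosure (map_continuous φ) (map_continuous ψ) ?_
  refine StarAlgHom.ext_adjoin ?_
  rintro ⟨_, _⟩ ⟨i, rfl⟩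
  exact h i

theorem gaugeHom_comp {d : ℕ} (z w : Fin d → Circle) :
    (gaugeHom z).comp (gaugeHom w) = gaugeHom (z * w) := by
  refine hom_ext fun i => ?_
  simp only [StarAlgHom.comp_apply, gaugeHom_gen, map_smul, smul_smul, Pi.mul_apply,
    Circle.coe_mul, mul_comm]

theorem gaugeHom_one {d : ℕ} : gaugeHom (1 : Fin d → Circle) = StarAlgHom.id ℂ _ := by
  refine hom_ext fun i => ?_
  simp [gaugeHom_gen]

/-- The gauge automorphism of `𝒪_d` with `sᵢ ↦ zᵢ sᵢ`. -/
def gaugeAut {d : ℕ} (z : Fin d → Circle) : CuntzAlgebra d ≃⋆ₐ[ℂ] CuntzAlgebra d :=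
  StarAlgEquiv.ofStarAlgHom (gaugeHom z) (gaugeHom z⁻¹)
    (by rw [gaugeHom_comp, inv_mul_cancel, gaugeHom_one])
    (by rw [gaugeHom_comp, mul_inv_cancel, gaugeHom_one])

/-- The one-parameter group `σ^L` of automorphisms of `𝒪_d`, with `σ_t(s_j) = e^{itL_j} s_j`. -/
def sigma {d : ℕ} (L : Fin d → ℤ) (t : ℝ) : CuntzAlgebra d ≃⋆ₐ[ℂ] CuntzAlgebra d :=
  gaugeAut fun j => Circle.exp (t * L j)

theorem sigma_gen {d : ℕ} (L : Fin d → ℤ) (t : ℝ) (j : Fin d) :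
    sigma L t (gen d j) = Complex.exp (Complex.I * t * L j) • gen d j := by
  change ((Circle.exp (t * L j) : Circle) : ℂ) • gen d j = _
  rw [Circle.coe_exp]
  congr 2
  push_cast
  ring

theorem sigma_add {d : ℕ} (L : Fin d → ℤ) (t u : ℝ) :
    sigma L (t + u) = sigma L t * sigma L u := by
  ext1 x
  have h := gaugeHom_comp (fun j => Circle.exp (t * L j)) (fun j => Circle.exp (u * L j))
  have h2 : ((fun j => Circle.exp (t * L j)) * (fun j => Circle.exp (u * L j))
      : Fin d → Circle) = fun j => Circle.exp ((t + u) * L j) := by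
    funext j
    simp only [Pi.mul_apply, add_mul, Circle.exp_add]
  rw [h2] at h
  exact (DFunLike.congr_fun h x).symm

/-- The fixed-point algebra `𝔄_L` of `σ^L`. -/
def fixedAlgebra {d : ℕ} (L : Fin d → ℤ) : StarSubalgebra ℂ (CuntzAlgebra d) where
  carrier := {x | ∀ t : ℝ, sigma L t x = x}
  mul_mem' hx hy t := by rw [map_mul, hx t, hy t]
  add_mem' hx hy t := by rw [map_add, hx t, hy t]
  algebraMap_mem' c t := by
    rw [Algebra.algebraMap_eq_smul_one, map_smul, map_one]
  star_mem' hx t := by rw [map_star, hx t]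

instance instIsClosedFixedAlgebra {d : ℕ} (L : Fin d → ℤ) :
    IsClosed (fixedAlgebra L : Set (CuntzAlgebra d)) := by
  have h : (fixedAlgebra L : Set (CuntzAlgebra d)) = ⋂ t : ℝ, {x | sigma L t x = x} := by
    ext x
    simp [fixedAlgebra]
  rw [h]
  exact isClosed_iInter fun t => isClosed_eq (map_continuous (sigma L t)) continuous_id

end CuntzAlgebra

/-- A C⋆-algebra is AF if it is the closure of the union of an increasing sequence of
finite-dimensional star subalgebras. -/
def IsAFAlgebra (A : Type*) [NonUnitalCStarAlgebra A] : Prop :=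
  ∃ F : ℕ → NonUnitalStarSubalgebra ℂ A, Monotone F ∧ (∀ n, FiniteDimensional ℂ (F n)) ∧
    closure (⋃ n, (F n : Set A)) = Set.univ

/-- A state on a unital C⋆-algebra: a positive linear functional of value `1` at the unit. -/
structure IsState {A : Type*} [CStarAlgebra A] (ω : A →ₗ[ℂ] ℂ) : Prop where
  nonneg : ∀ x, 0 ≤ ω (star x * x)
  map_one : ω 1 = 1

/-- `f` is the entire extension `z ↦ σ_z(y)` of the orbit `t ↦ σ_t(y)`; the element `y` is
`σ`-analytic if there is such an `f`, which is then unique. -/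
def IsEntireOrbit {A : Type*} [CStarAlgebra A] (σ : ℝ → A ≃⋆ₐ[ℂ] A) (y : A) (f : ℂ → A) : Prop :=
  Differentiable ℂ f ∧ ∀ t : ℝ, f t = σ t y

/-- `ω` is a `(σ, β)`-KMS state: `ω(x σ_{iβ}(y)) = ω(y x)` for all `x`, `y` in a norm-dense
`σ`-invariant star algebra of `σ`-analytic elements. -/
def IsKMSState {A : Type*} [CStarAlgebra A] (σ : ℝ → A ≃⋆ₐ[ℂ] A) (β : ℝ) (ω : A →ₗ[ℂ] ℂ) : Prop :=
  IsState ω ∧ ∃ B : NonUnitalStarSubalgebra ℂ A, Dense (B : Set A) ∧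
    (∀ t, ∀ x ∈ B, σ t x ∈ B) ∧
    ∀ y ∈ B, ∃ f : ℂ → A, IsEntireOrbit σ y f ∧
      ∀ x ∈ B, ω (x * f (Complex.I * β)) = ω (y * x)

end

/-! Write s_α for the product of generators along a word α and L(α) for its weight. Since σ_t
multiplies s_α s_β* by e^{it(L(α)-L(β))}, the fixed-point algebra is the closed span of the s_α s_β*
with L(α) = L(β) (`dense_span_balancedWords`).

Let all Lᵢ be positive; the negative case follows by replacing L with -L. Cut every infinite word at
its first prefix of weight at least n. The finitely many words obtained form an antichain for the
prefix order, so the s_α s_β* of equal weight built from them are matrix units and span a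
finite-dimensional algebra. Expanding words of weight exactly n by one letter, through ∑ sᵢ sᵢ* = 1,
embeds level n in level n + 1, and a balanced s_α s_β* occurs at level L(α). Hence the fixed-point
algebra is AF.

If the signs are not all strict and equal, some sᵢ or some sᵢ^m sⱼ^n is a fixed isometry with range
inside that of one generator, hence not unitary. A unital AF-algebra has no such isometry, because
one-sided inverses in finite dimension are two-sided (`IsAFAlgebra.mem_unitary`).

KMS states are governed by the equation ∑ e^{-βLᵢ} = 1. The KMS condition for y = sᵢ and x = sᵢ*
reads ω(sᵢ sᵢ*) = e^{-βLᵢ}, and summation gives the equation; as it has at least two positive terms,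
every βLᵢ is positive. The generators need not lie in the given dense algebra and are reached by
Fourier averaging (`IsKMSState.apply_eigenvector`). Conversely, a state fixed by φ ↦ ∑ e^{-βLᵢ}
φ(sᵢ* · sᵢ), found by averaging iterates (`exists_isState_transfer_eq`), is KMS. -/

/-! ### Cuntz families on ℓ² and nontriviality of the Cuntz algebra -/

section Representation

variable {ι : Type*}

/-- Composition with an injective map, as a bounded operator on `ℓ²`. -/
noncomputable def compInjective (g : ι → ι) (hg : Function.Injective g) :
    lp (fun _ : ι => ℂ) 2 →L[ℂ] lp (fun _ : ι => ℂ) 2 :=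
  LinearMap.mkContinuous
    { toFun := fun f => ⟨fun n => f (g n), by
        have h := (memℓp_gen_iff (by norm_num)).1 (lp.memℓp f)
        exact (memℓp_gen_iff (by norm_num)).2 (h.comp_injective hg)⟩
      map_add' := fun _ _ => rfl
      map_smul' := fun _ _ => rfl } 1 (by
    intro f
    rw [one_mul]
    refine lp.norm_le_of_forall_sum_le (by norm_num) (norm_nonneg f) fun s => ?_
    have h := lp.sum_rpow_le_norm_rpow (p := 2) (by norm_num) f (s.map ⟨g, hg⟩)
    rwa [Finset.sum_map] at h)

theorem compInjective_apply (g : ι → ι) (hg : Function.Injective g)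
    (f : lp (fun _ : ι => ℂ) 2) (n : ι) : compInjective g hg f n = f (g n) := rfl

/-- Composition with g is a coisometry; its adjoint is the isometry moving basis vectors along g.
This is why the Cuntz family below consists of adjoints. -/
theorem adjoint_compInjective_single [DecidableEq ι] (g : ι → ι) (hg : Function.Injective g)
    (n : ι) (a : ℂ) :
    (compInjective g hg).adjoint (lp.single 2 n a) = lp.single 2 (g n) a := by
  refine ext_inner_right ℂ fun f => ?_
  rw [ContinuousLinearMap.adjoint_inner_left, lp.inner_single_left, lp.inner_single_left,
    compInjective_apply]

theorem compInjective_single_of_eq [DecidableEq ι] (g : ι → ι) (hg : Function.Injective g)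
    (n : ι) (a : ℂ) :
    compInjective g hg (lp.single 2 (g n) a) = lp.single 2 n a := by
  refine lp.ext (funext fun m => (compInjective_apply g hg _ m).trans ?_)
  by_cases h : m = n
  · subst h
    exact (lp.single_apply_self (E := fun _ => ℂ) 2 (g m) a).trans
      (lp.single_apply_self (E := fun _ => ℂ) 2 m a).symm
  · exact (lp.single_apply_ne (E := fun _ => ℂ) 2 (g n) a (hg.ne h)).trans
      (lp.single_apply_ne (E := fun _ => ℂ) 2 n a h).symm

theorem compInjective_single_of_notMem_range [DecidableEq ι] (g : ι → ι)
    (hg : Function.Injective g) {k : ι} (hk : k ∉ Set.range g) (a : ℂ) :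
    compInjective g hg (lp.single 2 k a) = 0 :=
  lp.ext (funext fun m => (compInjective_apply g hg _ m).trans
    (lp.single_apply_ne (E := fun _ => ℂ) 2 k a fun h => hk ⟨m, h⟩))

/-- The coordinate operators on `ℓ²(ι)` given by a bijection `κ × ι ≃ ι`. -/
noncomputable def coordOperator {κ : Type*} (e : κ × ι ≃ ι) (i : κ) :
    lp (fun _ : ι => ℂ) 2 →L[ℂ] lp (fun _ : ι => ℂ) 2 :=
  compInjective (fun n => e (i, n)) fun _ _ h => congrArg Prod.snd (e.injective h)

theorem adjoint_coordOperator_single [DecidableEq ι] {κ : Type*} (e : κ × ι ≃ ι) (i : κ) (n : ι)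
    (a : ℂ) : (coordOperator e i).adjoint (lp.single 2 n a) = lp.single 2 (e (i, n)) a :=
  adjoint_compInjective_single _ _ n a

theorem coordOperator_single [DecidableEq ι] {κ : Type*} [DecidableEq κ] (e : κ × ι ≃ ι)
    (i j : κ) (n : ι) (a : ℂ) : coordOperator e i (lp.single 2 (e (j, n)) a) =
      if i = j then lp.single 2 n a else 0 := by
  split_ifs with h
  · subst h
    exact compInjective_single_of_eq _ _ n a
  · refine compInjective_single_of_notMem_range _ _ ?_ a
    rintro ⟨m, hm⟩
    exact h (congrArg Prod.fst (e.injective hm))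

/-- A bijection `Fin d × ι ≃ ι` gives a Cuntz family on `ℓ²(ι)`. -/
theorem isCuntzFamily_adjoint_coordOperator [DecidableEq ι] {d : ℕ} (e : Fin d × ι ≃ ι) :
    IsCuntzFamily (fun i : Fin d => (coordOperator e i).adjoint) where
  star_mul i j := by
    refine lp.ext_continuousLinearMap (by norm_num) fun n => ContinuousLinearMap.ext fun a => ?_
    rw [ContinuousLinearMap.star_eq_adjoint, ContinuousLinearMap.adjoint_adjoint]
    change coordOperator e i ((coordOperator e j).adjoint (lp.single 2 n a)) = _
    rw [adjoint_coordOperator_single, coordOperator_single]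
    split_ifs <;> rfl
  sum_mul_star := by
    refine lp.ext_continuousLinearMap (by norm_num) fun k => ContinuousLinearMap.ext fun a => ?_
    obtain ⟨⟨j, n⟩, rfl⟩ := e.surjective k
    simp only [ContinuousLinearMap.star_eq_adjoint, ContinuousLinearMap.adjoint_adjoint,
      ContinuousLinearMap.comp_apply, sum_apply]
    have h : ∀ i, ((coordOperator e i).adjoint * coordOperator e i) (lp.single 2 (e (j, n)) a) =
        if i = j then lp.single 2 (e (j, n)) a else 0 := by
      intro i
      change (coordOperator e i).adjoint (coordOperator e i (lp.single 2 (e (j, n)) a)) = _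
      rw [coordOperator_single]
      split_ifs with h
      · subst h
        exact adjoint_coordOperator_single e i n a
      · exact map_zero _
    refine (Finset.sum_congr rfl fun i _ => h i).trans ?_
    rw [Finset.sum_ite_eq', if_pos (Finset.mem_univ j)]
    rfl

end Representation

namespace CuntzAlgebra

/-- The Cuntz algebra has a representation on `ℓ²(ℕ)`. -/
theorem nonempty_representation {d : ℕ} (hd : 2 ≤ d) :
    Nonempty (CuntzAlgebra d →⋆ₐ[ℂ]
      (lp (fun _ : ℕ => ℂ) 2 →L[ℂ] lp (fun _ : ℕ => ℂ) 2)) := by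
  have : NeZero d := ⟨by omega⟩
  obtain ⟨e⟩ : Nonempty (Fin d × ℕ ≃ ℕ) := inferInstance
  have : Nontrivial (lp (fun _ : ℕ => ℂ) 2) :=
    ⟨lp.single 2 0 1, 0, fun h => by simpa using congrArg (fun f => f 0) h⟩
  obtain ⟨φ, -⟩ := exists_lift d (isCuntzFamily_adjoint_coordOperator e)
  exact ⟨φ⟩

/-- With no realization at all, the product defining the Cuntz algebra would be zero; a
representation on a nonzero space excludes this. -/
theorem nontrivial {d : ℕ} (hd : 2 ≤ d) : Nontrivial (CuntzAlgebra d) := by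
  obtain ⟨φ⟩ := nonempty_representation hd
  have : Nontrivial (lp (fun _ : ℕ => ℂ) 2) :=
    ⟨lp.single 2 0 1, 0, fun h => by simpa using congrArg (fun f => f 0) h⟩
  refine ⟨1, 0, fun h => one_ne_zero (α := lp (fun _ : ℕ => ℂ) 2 →L[ℂ] lp (fun _ : ℕ => ℂ) 2) ?_⟩
  rw [← map_one φ, h, map_zero]

end CuntzAlgebra

/-! ### Proper isometries and finiteness of AF-algebras -/

section Isometry

variable {d : ℕ} {A : Type*} [Ring A] [StarRing A] {s : Fin d → A}

theorem IsCuntzFamily.star_pow_mul_pow (hs : IsCuntzFamily s) (i : Fin d) (n : ℕ) :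
    star (s i ^ n) * s i ^ n = 1 := by
  induction n with
  | zero => simp
  | succ n ih =>
    have h : star (s i) * s i = 1 := by rw [hs.star_mul, if_pos rfl]
    rw [pow_succ, StarMul.star_mul, mul_assoc, ← mul_assoc _ _ (s i), ih, one_mul, h]

/-- An isometry whose range lies in that of one generator is not unitary. -/
theorem IsCuntzFamily.gen_mul_mul_star_ne_one [Nontrivial A] (hs : IsCuntzFamily s) {i j : Fin d}
    (hij : i ≠ j) (w : A) : s i * w * star (s i * w) ≠ 1 := by
  intro h
  have h1 : star (s j) * (s i * w * star (s i * w)) * s j = 0 := by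
    rw [mul_assoc (s i), ← mul_assoc (star (s j)), hs.star_mul, if_neg hij.symm, zero_mul,
      zero_mul]
  rw [h, mul_one, hs.star_mul, if_pos rfl] at h1
  exact one_ne_zero h1

end Isometry

/-- Left multiplication by a left-invertible element of a finite-dimensional subalgebra is
surjective, so the element is invertible. -/
theorem NonUnitalStarSubalgebra.isUnit_of_mul_eq_one {A : Type*} [CStarAlgebra A]
    (F : NonUnitalStarSubalgebra ℂ A) [FiniteDimensional ℂ F] {x y : A} (hx : x ∈ F)
    (hyx : y * x = 1) : IsUnit x := by
  let f : F →ₗ[ℂ] F := LinearMap.mulLeft ℂ (⟨x, hx⟩ : F)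
  have hf : Function.Injective f := by
    intro a b hab
    have h : x * a = x * b := congrArg Subtype.val hab
    apply Subtype.ext
    rw [← one_mul (a : A), ← one_mul (b : A), ← hyx, mul_assoc, mul_assoc, h]
  -- `F` is not assumed to contain the unit of `A`. Solving x u = x and cancelling x on the left
  -- shows u = 1, so the unit lies in `F` after all.
  have hsurj := LinearMap.injective_iff_surjective.1 hf
  obtain ⟨u, hu⟩ := hsurj ⟨x, hx⟩
  have hu : x * u = x := congrArg Subtype.val hu
  have hu1 : (u : A) = 1 := by rw [← one_mul (u : A), ← hyx, mul_assoc, hu]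
  obtain ⟨z, hz⟩ := hsurj u
  have hz : x * z = 1 := (congrArg Subtype.val hz).trans hu1
  exact ⟨⟨x, y, by rw [left_inv_eq_right_inv hyx hz, hz], hyx⟩, rfl⟩

/-- A unital AF-algebra is finite: its isometries are unitary. -/
theorem IsAFAlgebra.mem_unitary {A : Type*} [CStarAlgebra A] (hA : IsAFAlgebra A) {v : A}
    (hv : star v * v = 1) : v ∈ unitary A := by
  obtain ⟨F, -, hfin, hF⟩ := hA
  rcases subsingleton_or_nontrivial A with h | h
  · exact ⟨hv, Subsingleton.elim _ _⟩
  have hv1 : ‖star v‖ ≤ 1 := by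
    have h2 := CStarRing.norm_star_mul_self (x := v)
    rw [hv, norm_one] at h2
    rw [norm_star]
    nlinarith [norm_nonneg v]
  obtain ⟨x, hx, hvx⟩ := Metric.mem_closure_iff.1 (hF ▸ Set.mem_univ v :
    v ∈ closure (⋃ n, (F n : Set A))) 1 one_pos
  obtain ⟨n, hx⟩ := Set.mem_iUnion.1 hx
  -- v* x is within distance 1 of v* v = 1. Thus x has a left inverse and is invertible, and then so
  -- is v*.
  have hunit : IsUnit (star v * x) := by
    have h3 : ‖star v * (v - x)‖ < 1 := by
      refine (norm_mul_le _ _).trans_lt ?_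
      rw [dist_eq_norm] at hvx
      nlinarith [norm_nonneg (v - x), norm_nonneg (star v)]
    have h4 := isUnit_one_sub_of_norm_lt_one h3
    rwa [mul_sub, hv, sub_sub_cancel] at h4
  obtain ⟨u, hu⟩ := hunit
  have hxu : IsUnit x := by
    have := hfin n
    refine (F n).isUnit_of_mul_eq_one hx (y := ↑u⁻¹ * star v) ?_
    rw [mul_assoc, ← hu, Units.inv_mul]
  have hsv : IsUnit (star v) := by
    have h5 : IsUnit (star v * x) := ⟨u, hu⟩
    exact (hxu.unit.isUnit_mul_units (star v)).1 h5
  refine ⟨hv, ?_⟩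
  obtain ⟨w, hw⟩ := hsv
  have h6 : v = ↑w⁻¹ := by
    rw [← one_mul v, ← Units.inv_mul w, mul_assoc, hw, hv, mul_one]
  rw [← hw, h6, Units.inv_mul]

namespace CuntzAlgebra

variable {d : ℕ} (L : Fin d → ℤ)

theorem gen_mem_fixedAlgebra {i : Fin d} (hi : L i = 0) : gen d i ∈ fixedAlgebra L := by
  intro t
  rw [sigma_gen, hi]
  simp

theorem pow_mul_pow_mem_fixedAlgebra {i j : Fin d} {m n : ℕ} (h : m * L i + n * L j = 0) :
    gen d i ^ m * gen d j ^ n ∈ fixedAlgebra L := by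
  intro t
  rw [map_mul, map_pow, map_pow, sigma_gen, sigma_gen, smul_pow, smul_pow, smul_mul_smul_comm,
    ← Complex.exp_nat_mul, ← Complex.exp_nat_mul, ← Complex.exp_add]
  have h2 : (m : ℂ) * L i + n * L j = 0 := by exact_mod_cast h
  have h3 : (m : ℂ) * (Complex.I * t * L i) + n * (Complex.I * t * L j) = 0 := by
    linear_combination Complex.I * t * h2
  rw [h3, Complex.exp_zero, one_smul]

/-- If the `Lᵢ` are not all positive and not all negative, then the fixed-point algebra contains a
proper isometry. -/
theorem exists_isometry_notMem_unitary (hd : 2 ≤ d)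
    (hL : ¬ ((∀ i, 0 < L i) ∨ (∀ i, L i < 0))) :
    ∃ v : fixedAlgebra L, star v * v = 1 ∧ v ∉ unitary (fixedAlgebra L) := by
  have := nontrivial hd
  have hs := isCuntzFamily_gen d
  suffices h : ∃ (i : Fin d) (w : CuntzAlgebra d), gen d i * w ∈ fixedAlgebra L ∧
      star (gen d i * w) * (gen d i * w) = 1 by
    obtain ⟨i, w, hmem, hiso⟩ := h
    refine ⟨⟨gen d i * w, hmem⟩, Subtype.ext hiso, fun hu => ?_⟩
    have : Nontrivial (Fin d) := Fin.nontrivial_iff_two_le.2 hd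
    obtain ⟨j, hj⟩ := exists_ne i
    exact hs.gen_mul_mul_star_ne_one hj.symm w (congrArg Subtype.val hu.2)
  have hiso : ∀ i, L i = 0 → ∃ (i : Fin d) (w : CuntzAlgebra d), gen d i * w ∈ fixedAlgebra L ∧
      star (gen d i * w) * (gen d i * w) = 1 := fun i hi =>
    ⟨i, 1, by rw [mul_one]; exact gen_mem_fixedAlgebra L hi, by
      rw [mul_one, hs.star_mul, if_pos rfl]⟩
  push Not at hL
  obtain ⟨⟨i, hi⟩, ⟨j, hj⟩⟩ := hL
  rcases hi.eq_or_lt with hi | hi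
  · exact hiso i hi
  rcases hj.eq_or_lt with hj | hj
  · exact hiso j hj.symm
  -- With m = Lⱼ > 0 and n = -Lᵢ, the weight m Lᵢ + n Lⱼ vanishes. Since m is positive, a first
  -- factor sᵢ can be split off.
  obtain ⟨m, hm⟩ := Int.eq_ofNat_of_zero_le hj.le
  obtain ⟨n, hn⟩ := Int.eq_ofNat_of_zero_le (neg_nonneg.2 hi.le)
  obtain ⟨k, rfl⟩ : ∃ k, m = k + 1 := ⟨m - 1, by omega⟩
  have hw : gen d i * (gen d i ^ k * gen d j ^ n) = gen d i ^ (k + 1) * gen d j ^ n := by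
    rw [← mul_assoc, ← pow_succ']
  refine ⟨i, gen d i ^ k * gen d j ^ n, ?_, ?_⟩
  · rw [hw]
    refine pow_mul_pow_mem_fixedAlgebra L ?_
    rw [hm, ← hm, ← hn, hm]
    ring
  · rw [hw, star_mul, mul_assoc, ← mul_assoc _ _ (gen d j ^ n), hs.star_pow_mul_pow, one_mul,
      hs.star_pow_mul_pow]

end CuntzAlgebra

/-! ### Words, weights and threshold words -/

/-- The product `s_α = s_{α₁} ⋯ s_{αₙ}` along a word `α`. -/
def wordProd {ι A : Type*} [Monoid A] (s : ι → A) (α : List ι) : A := (α.map s).prod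

/-- The weight `L(α) = L_{α₁} + ⋯ + L_{αₙ}` of a word `α`. -/
def wordWeight {ι : Type*} (L : ι → ℤ) (α : List ι) : ℤ := (α.map L).sum

section Words

variable {ι A : Type*} [Monoid A] (s : ι → A) (L : ι → ℤ)

@[simp] theorem wordProd_nil : wordProd s [] = 1 := rfl

@[simp] theorem wordProd_cons (i : ι) (α : List ι) :
    wordProd s (i :: α) = s i * wordProd s α := by simp [wordProd]

@[simp] theorem wordProd_append (α β : List ι) :
    wordProd s (α ++ β) = wordProd s α * wordProd s β := by simp [wordProd]

@[simp] theorem wordWeight_nil : wordWeight L [] = 0 := rfl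

@[simp] theorem wordWeight_cons (i : ι) (α : List ι) :
    wordWeight L (i :: α) = L i + wordWeight L α := by simp [wordWeight]

@[simp] theorem wordWeight_append (α β : List ι) :
    wordWeight L (α ++ β) = wordWeight L α + wordWeight L β := by simp [wordWeight]

theorem length_le_wordWeight {L : ι → ℤ} (hL : ∀ i, 0 < L i) (α : List ι) :
    (α.length : ℤ) ≤ wordWeight L α := by
  induction α with
  | nil => simp
  | cons i α ih =>
    have := hL i
    simp only [List.length_cons, wordWeight_cons]
    push_cast
    omega

/-- The word `α` is minimal, for the prefix order, among the words of weight at least `n`. -/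
def IsThresholdWord (n : ℕ) (α : List ι) : Prop :=
  (n : ℤ) ≤ wordWeight L α ∧ ∀ γ, γ <+: α → γ ≠ α → wordWeight L γ < n

variable {L}

theorem IsThresholdWord.eq_of_prefix {n : ℕ} {α β : List ι} (hα : IsThresholdWord L n α)
    (hβ : IsThresholdWord L n β) (h : α <+: β) : α = β := by
  by_contra hne
  exact (hβ.2 α h hne).not_ge hα.1

/-- Without its last letter the word weighs less than n, and length is at most weight. -/
theorem IsThresholdWord.length_le (hL : ∀ i, 0 < L i) {n : ℕ} {α : List ι}
    (hα : IsThresholdWord L n α) : α.length ≤ n := by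
  rcases eq_or_ne α [] with rfl | hne
  · simp
  have h1 := hα.2 α.dropLast (List.dropLast_prefix α) fun h => by
    have := congrArg List.length h
    have := List.length_pos_iff.2 hne
    simp only [List.length_dropLast] at *
    omega
  have h2 := length_le_wordWeight hL α.dropLast
  rw [List.length_dropLast] at h2
  omega

theorem finite_isThresholdWord [Finite ι] (hL : ∀ i, 0 < L i) (n : ℕ) :
    {α : List ι | IsThresholdWord L n α}.Finite :=
  (List.finite_length_le ι n).subset fun _ hα => hα.length_le hL

theorem isThresholdWord_of_wordWeight_eq (hL : ∀ i, 0 < L i) {n : ℕ} {α : List ι}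
    (hα : wordWeight L α = n) : IsThresholdWord L n α := by
  refine ⟨hα.ge, ?_⟩
  rintro γ ⟨δ, rfl⟩ hne
  have h1 := length_le_wordWeight hL δ
  have h2 : 0 < δ.length := List.length_pos_iff.2 (by rintro rfl; simp at hne)
  rw [wordWeight_append] at hα
  omega

/-- Together with `append_singleton` this describes the passage from n to n + 1: heavier words
survive, words of weight exactly n are replaced by their one-letter extensions. -/
theorem IsThresholdWord.succ {n : ℕ} {α : List ι} (hα : IsThresholdWord L n α)
    (h : wordWeight L α ≠ n) : IsThresholdWord L (n + 1) α := by
  refine ⟨?_, fun γ hγ hne => ?_⟩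
  · have := hα.1
    push_cast
    omega
  · have := hα.2 γ hγ hne
    push_cast
    omega

theorem IsThresholdWord.append_singleton (hL : ∀ i, 0 < L i) {n : ℕ} {α : List ι}
    (hα : IsThresholdWord L n α) (h : wordWeight L α = n) (i : ι) :
    IsThresholdWord L (n + 1) (α ++ [i]) := by
  have hi := hL i
  refine ⟨?_, fun γ hγ hne => ?_⟩
  · rw [wordWeight_append, wordWeight_cons, wordWeight_nil]
    push_cast
    omega
  · rcases List.prefix_concat_iff.1 (by simpa using hγ) with h1 | h1
    · exact absurd (by simpa using h1) hne
    · by_cases h2 : γ = α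
      · subst h2
        push_cast
        omega
      · have := hα.2 γ h1 h2
        push_cast
        omega

end Words

/-! ### Products of generators along words -/

namespace IsCuntzFamily

variable {d : ℕ} {A : Type*} [Ring A] [StarRing A] {s : Fin d → A}

theorem star_wordProd_mul_self (hs : IsCuntzFamily s) (α : List (Fin d)) :
    star (wordProd s α) * wordProd s α = 1 := by
  induction α with
  | nil => simp
  | cons i α ih =>
    rw [wordProd_cons, StarMul.star_mul, mul_assoc, ← mul_assoc (star (s i)), hs.star_mul,
      if_pos rfl, one_mul, ih]

/-- Equal initial letters cancel; incomparable words then reach a first differing letter, where sᵢ*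
sⱼ = 0. -/
theorem star_wordProd_mul_eq_zero (hs : IsCuntzFamily s) {α β : List (Fin d)}
    (h1 : ¬ α <+: β) (h2 : ¬ β <+: α) :
    star (wordProd s α) * wordProd s β = 0 := by
  induction α generalizing β with
  | nil => simp at h1
  | cons i α ih =>
    cases β with
    | nil => simp at h2
    | cons j β =>
      rw [wordProd_cons, wordProd_cons, StarMul.star_mul, mul_assoc, ← mul_assoc (star (s i)),
        hs.star_mul]
      split_ifs with hij
      · subst hij
        rw [one_mul]
        exact ih (by simpa [List.cons_prefix_cons] using h1)
          (by simpa [List.cons_prefix_cons] using h2)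
      · simp

theorem star_wordProd_mul_of_isThresholdWord (hs : IsCuntzFamily s) {L : Fin d → ℤ}
    {n : ℕ} {α β : List (Fin d)} (hα : IsThresholdWord L n α) (hβ : IsThresholdWord L n β) :
    star (wordProd s α) * wordProd s β = if α = β then 1 else 0 := by
  split_ifs with h
  · rw [h, hs.star_wordProd_mul_self]
  · exact hs.star_wordProd_mul_eq_zero (fun h1 => h (hα.eq_of_prefix hβ h1))
      (fun h1 => h (hβ.eq_of_prefix hα h1).symm)

theorem sum_wordProd_append_singleton (hs : IsCuntzFamily s) (α β : List (Fin d)) :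
    ∑ i, wordProd s (α ++ [i]) * star (wordProd s (β ++ [i])) =
      wordProd s α * star (wordProd s β) := by
  have h : ∀ i, wordProd s (α ++ [i]) * star (wordProd s (β ++ [i])) =
      wordProd s α * (s i * star (s i)) * star (wordProd s β) := fun i => by
    simp [mul_assoc]
  rw [Finset.sum_congr rfl fun i _ => h i, ← Finset.sum_mul, ← Finset.mul_sum, hs.sum_mul_star,
    mul_one]

/-- The star algebra generated by a Cuntz family is spanned by the elements `s_α s_β*`. -/
theorem adjoin_le_span [Algebra ℂ A] [StarModule ℂ A] (hs : IsCuntzFamily s) :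
    Subalgebra.toSubmodule (StarAlgebra.adjoin ℂ (Set.range s)).toSubalgebra ≤
      Submodule.span ℂ
        {x | ∃ α β, x = wordProd s α * star (wordProd s β)} := by
  set M : Submodule ℂ A :=
    Submodule.span ℂ {x | ∃ α β, x = wordProd s α * star (wordProd s β)} with hM
  have hM1 : (1 : A) ∈ M := Submodule.subset_span ⟨[], [], by simp⟩
  intro a ha
  -- Invariance of the span under left multiplication by a passes through products, so it only needs
  -- checking on generators and their adjoints.
  suffices h : ∀ y ∈ M, a * y ∈ M by simpa using h 1 hM1
  replace ha : a ∈ Algebra.adjoin ℂ (Set.range s ∪ star (Set.range s)) := ha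
  induction ha using Algebra.adjoin_induction with
  | mem x hx =>
    intro y hy
    induction hy using Submodule.span_induction with
    | mem y hy =>
      obtain ⟨α, β, rfl⟩ := hy
      rcases hx with ⟨i, rfl⟩ | ⟨i, hi⟩
      · exact Submodule.subset_span ⟨i :: α, β, by simp [mul_assoc]⟩
      · obtain rfl : x = star (s i) := by rw [hi, star_star]
        cases α with
        | nil => exact Submodule.subset_span ⟨[], β ++ [i], by simp⟩
        | cons j α =>
          rw [wordProd_cons, mul_assoc, ← mul_assoc (star (s i)), hs.star_mul]
          split_ifs with hij
          · exact Submodule.subset_span ⟨α, β, by simp⟩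
          · simp
    | zero => simp
    | add y z _ _ hy hz => rw [mul_add]; exact M.add_mem hy hz
    | smul c y _ hy => rw [mul_smul_comm]; exact M.smul_mem c hy
  | algebraMap r =>
    intro y hy
    rw [← Algebra.smul_def]
    exact M.smul_mem r hy
  | add x y _ _ hx hy =>
    intro z hz
    rw [add_mul]
    exact M.add_mem (hx z hz) (hy z hz)
  | mul x y _ _ hx hy =>
    intro z hz
    rw [mul_assoc]
    exact hx _ (hy z hz)

end IsCuntzFamily

/-! ### Averaging over roots of unity and density of balanced words -/

namespace CuntzAlgebra

variable {d : ℕ} (L : Fin d → ℤ)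

/-- The star algebra generated by the canonical generators is dense. -/
theorem dense_adjoin_gen (d : ℕ) :
    Dense (StarAlgebra.adjoin ℂ (Set.range (gen d)) : Set (CuntzAlgebra d)) := by
  have himg : ((StarAlgebra.adjoin ℂ (Set.range (gen d))).map (cuntzSubalgebra d).subtype) =
      StarAlgebra.adjoin ℂ (Set.range (cuntzProductGen d)) := by
    rw [StarAlgHom.map_adjoin, ← Set.range_comp]
    rfl
  rw [Subtype.dense_iff]
  intro x hx
  have hx : x ∈ closure (StarAlgebra.adjoin ℂ (Set.range (cuntzProductGen d)) :
    Set (CuntzProduct d)) := hx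
  rw [← himg] at hx
  exact hx

theorem exp_ne_one {m : ℤ} {K : ℕ} (hK : m.natAbs < K) (hm : m ≠ 0) :
    Complex.exp (Complex.I * (2 * Real.pi / K : ℝ) * m) ≠ 1 := by
  intro h
  obtain ⟨n, hn⟩ := Complex.exp_eq_one_iff.1 h
  have hK0 : (K : ℂ) ≠ 0 := by
    have : K ≠ 0 := by omega
    exact_mod_cast this
  have hpi : (Real.pi : ℂ) ≠ 0 := by exact_mod_cast Real.pi_ne_zero
  push_cast at hn
  field_simp at hn
  have hn2 : (m : ℂ) = K * n := by
    linear_combination hn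
  have hn3 : m = K * n := by exact_mod_cast hn2
  have : (K : ℤ) ∣ m := ⟨n, hn3⟩
  have := Int.natAbs_dvd_natAbs.2 this
  have := Nat.le_of_dvd (by omega) this
  simp at this
  omega

theorem sigma_wordProd (t : ℝ) (α : List (Fin d)) :
    sigma L t (wordProd (gen d) α) =
      Complex.exp (Complex.I * t * wordWeight L α) • wordProd (gen d) α := by
  induction α with
  | nil => simp
  | cons i α ih =>
    rw [wordProd_cons, map_mul, sigma_gen, ih, smul_mul_smul_comm, ← Complex.exp_add,
      wordWeight_cons]
    congr 2
    push_cast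
    ring

theorem sigma_wordProd_mul_star (t : ℝ) (α β : List (Fin d)) :
    sigma L t (wordProd (gen d) α * star (wordProd (gen d) β)) =
      Complex.exp (Complex.I * t * (wordWeight L α - wordWeight L β : ℤ)) •
        (wordProd (gen d) α * star (wordProd (gen d) β)) := by
  rw [map_mul, map_star, sigma_wordProd, sigma_wordProd, star_smul, smul_mul_smul_comm,
    Complex.star_def, ← Complex.exp_conj, ← Complex.exp_add]
  congr 2
  simp
  ring

/-- The average of `σ_t` over the multiples `t` of `2π / K`. -/
noncomputable def rootAverage (K : ℕ) : CuntzAlgebra d →ₗ[ℂ] CuntzAlgebra d :=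
  (K : ℂ)⁻¹ • ∑ k ∈ Finset.range K,
    ((sigma L (k * (2 * Real.pi / K))).toAlgEquiv.toLinearMap)

theorem rootAverage_apply (K : ℕ) (x : CuntzAlgebra d) : rootAverage L K x =
    (K : ℂ)⁻¹ • ∑ k ∈ Finset.range K, sigma L (k * (2 * Real.pi / K)) x := by
  simp [rootAverage, LinearMap.sum_apply]

theorem norm_sigma (t : ℝ) (x : CuntzAlgebra d) : ‖sigma L t x‖ = ‖x‖ :=
  NonUnitalStarAlgHom.norm_map (sigma L t) (sigma L t).injective x

theorem norm_rootAverage_le {K : ℕ} (x : CuntzAlgebra d) : ‖rootAverage L K x‖ ≤ ‖x‖ := by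
  rw [rootAverage_apply, norm_smul, norm_inv, Complex.norm_natCast]
  rcases Nat.eq_zero_or_pos K with rfl | hK
  · simp
  have hK : (0 : ℝ) < K := by exact_mod_cast hK
  rw [inv_mul_le_iff₀ hK]
  refine (norm_sum_le _ _).trans ?_
  rw [Finset.sum_congr rfl fun k _ => norm_sigma L _ x, Finset.sum_const, Finset.card_range,
    nsmul_eq_mul]

theorem rootAverage_of_mem {K : ℕ} (hK : 0 < K) {x : CuntzAlgebra d} (hx : x ∈ fixedAlgebra L) :
    rootAverage L K x = x := by
  have hK : (K : ℂ) ≠ 0 := by exact_mod_cast hK.ne'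
  rw [rootAverage_apply, Finset.sum_congr rfl fun k _ => hx _, Finset.sum_const,
    Finset.card_range, ← Nat.cast_smul_eq_nsmul ℂ, smul_smul, inv_mul_cancel₀ hK, one_smul]

theorem wordProd_mul_star_mem_fixedAlgebra {α β : List (Fin d)}
    (h : wordWeight L α = wordWeight L β) :
    wordProd (gen d) α * star (wordProd (gen d) β) ∈ fixedAlgebra L := by
  intro t
  rw [sigma_wordProd_mul_star, h]
  simp

/-- The average is a geometric sum of a K-th root of unity, different from 1 because the nonzero
weight difference is smaller than K in absolute value. -/
theorem rootAverage_wordProd_eq_zero {K : ℕ} {α β : List (Fin d)}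
    (h : wordWeight L α ≠ wordWeight L β) (hK : (wordWeight L α - wordWeight L β).natAbs < K) :
    rootAverage L K (wordProd (gen d) α * star (wordProd (gen d) β)) = 0 := by
  have hK0 : (K : ℂ) ≠ 0 := by
    have : K ≠ 0 := by omega
    exact_mod_cast this
  set m := wordWeight L α - wordWeight L β with hm
  set ζ := Complex.exp (Complex.I * (2 * Real.pi / K : ℝ) * m) with hζ
  have hζ1 : ζ ≠ 1 := exp_ne_one hK (sub_ne_zero.2 h)
  have hζK : ζ ^ K = 1 := by
    rw [hζ, ← Complex.exp_nat_mul, Complex.exp_eq_one_iff]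
    refine ⟨m, ?_⟩
    push_cast
    field_simp
  have hterm : ∀ k : ℕ, sigma L (k * (2 * Real.pi / K))
      (wordProd (gen d) α * star (wordProd (gen d) β)) =
      ζ ^ k • (wordProd (gen d) α * star (wordProd (gen d) β)) := by
    intro k
    rw [sigma_wordProd_mul_star, hζ, ← Complex.exp_nat_mul, ← hm]
    congr 2
    push_cast
    ring
  rw [rootAverage_apply, Finset.sum_congr rfl fun k _ => hterm k, ← Finset.sum_smul,
    geom_sum_eq hζ1, hζK, sub_self, zero_div, zero_smul, smul_zero]

/-- The elements `s_α s_β*` with `L(α) = L(β)`, in the fixed-point algebra. -/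
def balancedWords : Set (fixedAlgebra L) :=
  {x | ∃ α β, wordWeight L α = wordWeight L β ∧
    (x : CuntzAlgebra d) = wordProd (gen d) α * star (wordProd (gen d) β)}

/-- Only finitely many frequencies occur in p, so a finite average with K large enough projects p
onto its part of frequency zero, with no integral needed. -/
theorem exists_rootAverage_mem {p : CuntzAlgebra d}
    (hp : p ∈ Submodule.span ℂ
      {x | ∃ α β, x = wordProd (gen d) α * star (wordProd (gen d) β)}) :
    ∃ N : ℕ, ∀ K, N < K → ∃ q ∈ Submodule.span ℂ (balancedWords L), rootAverage L K p = q := by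
  induction hp using Submodule.span_induction with
  | mem x hx =>
    obtain ⟨α, β, rfl⟩ := hx
    refine ⟨(wordWeight L α - wordWeight L β).natAbs, fun K hK => ?_⟩
    by_cases h : wordWeight L α = wordWeight L β
    · have hmem := wordProd_mul_star_mem_fixedAlgebra L h
      exact ⟨⟨_, hmem⟩, Submodule.subset_span ⟨α, β, h, rfl⟩,
        rootAverage_of_mem L (by omega) hmem⟩
    · exact ⟨0, zero_mem _, rootAverage_wordProd_eq_zero L h hK⟩
  | zero => exact ⟨0, fun K _ => ⟨0, zero_mem _, map_zero _⟩⟩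
  | add x y _ _ hx hy =>
    obtain ⟨M, hM⟩ := hx
    obtain ⟨N, hN⟩ := hy
    refine ⟨max M N, fun K hK => ?_⟩
    obtain ⟨q, hq, hqx⟩ := hM K ((le_max_left _ _).trans_lt hK)
    obtain ⟨r, hr, hry⟩ := hN K ((le_max_right _ _).trans_lt hK)
    exact ⟨q + r, add_mem hq hr, by rw [map_add, hqx, hry]; rfl⟩
  | smul c x _ hx =>
    obtain ⟨N, hN⟩ := hx
    refine ⟨N, fun K hK => ?_⟩
    obtain ⟨q, hq, hqx⟩ := hN K hK
    exact ⟨c • q, Submodule.smul_mem _ c hq, by rw [map_smul, hqx]; rfl⟩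

/-- The elements `s_α s_β*` with `L(α) = L(β)` span a dense subspace of the fixed-point algebra. -/
theorem dense_span_balancedWords :
    Dense (Submodule.span ℂ (balancedWords L) : Set (fixedAlgebra L)) := by
  intro x
  rw [Metric.mem_closure_iff]
  intro ε hε
  obtain ⟨p, hp, hxp⟩ := Metric.mem_closure_iff.1 (dense_adjoin_gen d (x : CuntzAlgebra d)) ε hε
  obtain ⟨N, hN⟩ := exists_rootAverage_mem L ((isCuntzFamily_gen d).adjoin_le_span hp)
  obtain ⟨q, hq, hpq⟩ := hN (N + 1) (Nat.lt_succ_self N)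
  refine ⟨q, hq, ?_⟩
  -- The average fixes x and sends p to q, so x - q is the average of x - p, and averaging is a
  -- contraction.
  rw [Subtype.dist_eq, ← hpq, dist_eq_norm, ← rootAverage_of_mem L N.succ_pos x.2,
    Nat.succ_eq_add_one, ← map_sub]
  rw [dist_eq_norm] at hxp
  exact (norm_rootAverage_le L _).trans_lt hxp

/-! ### Matrix units and the AF property -/

/-- The elements `s_α s_β*` with `L(α) = L(β)` and `α`, `β` threshold words for `n`. -/
def thresholdUnits (n : ℕ) : Set (fixedAlgebra L) :=
  {x | ∃ α β, IsThresholdWord L n α ∧ IsThresholdWord L n β ∧ wordWeight L α = wordWeight L β ∧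
    (x : CuntzAlgebra d) = wordProd (gen d) α * star (wordProd (gen d) β)}

theorem finite_thresholdUnits (hL : ∀ i, 0 < L i) (n : ℕ) : (thresholdUnits L n).Finite := by
  have h := ((finite_isThresholdWord hL n).image2
    (fun α β => wordProd (gen d) α * star (wordProd (gen d) β)) (finite_isThresholdWord hL n))
  refine (h.preimage (f := ((↑) : fixedAlgebra L → CuntzAlgebra d))
    Subtype.val_injective.injOn).subset ?_
  rintro x ⟨α, β, hα, hβ, -, hx⟩
  exact ⟨α, hα, β, hβ, hx.symm⟩

/-- The span of the threshold units is a star subalgebra: they form a system of matrix units. -/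
noncomputable def thresholdAlgebra (n : ℕ) : NonUnitalStarSubalgebra ℂ (fixedAlgebra L) where
  __ := Submodule.span ℂ (thresholdUnits L n)
  mul_mem' := by
    intro a b ha hb
    change a ∈ Submodule.span ℂ (thresholdUnits L n) at ha
    change b ∈ Submodule.span ℂ (thresholdUnits L n) at hb
    change a * b ∈ Submodule.span ℂ (thresholdUnits L n)
    induction ha, hb using Submodule.span_induction₂ with
    | mem_mem x y hx hy =>
      obtain ⟨α, β, hα, hβ, h1, hx⟩ := hx
      obtain ⟨γ, δ, hγ, hδ, h2, hy⟩ := hy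
      have hxy : ((x * y : fixedAlgebra L) : CuntzAlgebra d) =
          wordProd (gen d) α * (if β = γ then 1 else 0) * star (wordProd (gen d) δ) := by
        rw [← (isCuntzFamily_gen d).star_wordProd_mul_of_isThresholdWord hβ hγ]
        change (x : CuntzAlgebra d) * (y : CuntzAlgebra d) = _
        rw [hx, hy]
        simp only [mul_assoc]
      by_cases h : β = γ
      · refine Submodule.subset_span ⟨α, δ, hα, hδ, by rw [h1, h, h2], ?_⟩
        rw [hxy, if_pos h, mul_one]
      · have h0 : x * y = 0 := Subtype.ext (by rw [hxy, if_neg h, mul_zero, zero_mul]; rfl)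
        rw [h0]
        exact zero_mem _
    | zero_left => simp
    | zero_right => simp
    | add_left x y z _ _ _ hx hy => rw [add_mul]; exact add_mem hx hy
    | add_right x y z _ _ _ hx hy => rw [mul_add]; exact add_mem hx hy
    | smul_left r x y _ _ h => rw [smul_mul_assoc]; exact Submodule.smul_mem _ r h
    | smul_right r x y _ _ h => rw [mul_smul_comm]; exact Submodule.smul_mem _ r h
  star_mem' := by
    intro a ha
    change a ∈ Submodule.span ℂ (thresholdUnits L n) at ha
    change star a ∈ Submodule.span ℂ (thresholdUnits L n)
    induction ha using Submodule.span_induction with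
    | mem x hx =>
      obtain ⟨α, β, hα, hβ, h, hx⟩ := hx
      refine Submodule.subset_span ⟨β, α, hβ, hα, h.symm, ?_⟩
      change star (x : CuntzAlgebra d) = _
      rw [hx, star_mul, star_star]
    | zero => simp
    | add x y _ _ hx hy => rw [star_add]; exact add_mem hx hy
    | smul c x _ hx => rw [star_smul]; exact Submodule.smul_mem _ _ hx

/-- The two words of a unit have equal weight, so both survive to level n + 1 or both are extended;
in the latter case the unit is the sum of its extensions. -/
theorem monotone_thresholdAlgebra (hL : ∀ i, 0 < L i) : Monotone (thresholdAlgebra L) := by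
  refine monotone_nat_of_le_succ fun n => ?_
  have h : Submodule.span ℂ (thresholdUnits L n) ≤ Submodule.span ℂ (thresholdUnits L (n + 1)) := by
    rw [Submodule.span_le]
    rintro x ⟨α, β, hα, hβ, h, hx⟩
    by_cases hn : wordWeight L α = n
    · have hn' : wordWeight L β = n := h ▸ hn
      have hw : ∀ i, wordWeight L (α ++ [i]) = wordWeight L (β ++ [i]) := fun i => by simp [h]
      have hsum : x = ∑ i, (⟨_, wordProd_mul_star_mem_fixedAlgebra L (hw i)⟩ : fixedAlgebra L) := by
        apply Subtype.ext
        rw [hx, ← (isCuntzFamily_gen d).sum_wordProd_append_singleton,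
          AddSubmonoidClass.coe_finsetSum]
      rw [hsum]
      exact sum_mem fun i _ => Submodule.subset_span
        ⟨_, _, hα.append_singleton hL hn i, hβ.append_singleton hL hn' i, hw i, rfl⟩
    · exact Submodule.subset_span ⟨α, β, hα.succ hn, hβ.succ (h ▸ hn), h, hx⟩
  exact h

theorem exists_mem_thresholdAlgebra (hL : ∀ i, 0 < L i) {x : fixedAlgebra L}
    (hx : x ∈ Submodule.span ℂ (balancedWords L)) : ∃ n, x ∈ thresholdAlgebra L n := by
  induction hx using Submodule.span_induction with
  | mem x hx =>
    obtain ⟨α, β, h, hx⟩ := hx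
    have h0 := length_le_wordWeight hL α
    obtain ⟨n, hn⟩ := Int.eq_ofNat_of_zero_le (show 0 ≤ wordWeight L α by omega)
    exact ⟨n, Submodule.subset_span ⟨α, β, isThresholdWord_of_wordWeight_eq hL hn,
      isThresholdWord_of_wordWeight_eq hL (h ▸ hn), h, hx⟩⟩
  | zero => exact ⟨0, zero_mem _⟩
  | add x y _ _ hx hy =>
    obtain ⟨m, hm⟩ := hx
    obtain ⟨n, hn⟩ := hy
    exact ⟨max m n, add_mem (monotone_thresholdAlgebra L hL (le_max_left m n) hm)
      (monotone_thresholdAlgebra L hL (le_max_right m n) hn)⟩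
  | smul c x _ hx =>
    obtain ⟨n, hn⟩ := hx
    exact ⟨n, SMulMemClass.smul_mem c hn⟩

theorem isAFAlgebra_fixedAlgebra_of_pos (hL : ∀ i, 0 < L i) : IsAFAlgebra (fixedAlgebra L) := by
  refine ⟨thresholdAlgebra L, monotone_thresholdAlgebra L hL, fun n => ?_, ?_⟩
  · exact FiniteDimensional.span_of_finite ℂ (finite_thresholdUnits L hL n)
  · refine ((dense_span_balancedWords L).mono fun x hx => ?_).closure_eq
    exact Set.mem_iUnion.2 (exists_mem_thresholdAlgebra L hL hx)

theorem sigma_neg (t : ℝ) : sigma (-L) t = sigma L (-t) := by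
  simp [sigma]

theorem fixedAlgebra_neg : fixedAlgebra (-L) = fixedAlgebra L := by
  refine SetLike.ext fun x => ⟨fun h t => ?_, fun h t => ?_⟩
  · have := h (-t)
    rwa [sigma_neg, neg_neg] at this
  · rw [sigma_neg]
    exact h (-t)

theorem isAFAlgebra_of_eq {S T : StarSubalgebra ℂ (CuntzAlgebra d)}
    [IsClosed (S : Set (CuntzAlgebra d))] [IsClosed (T : Set (CuntzAlgebra d))] (h : S = T)
    (hS : IsAFAlgebra S) : IsAFAlgebra T := by
  subst h
  exact hS

/-- If the `Lᵢ` have the same strict sign, then the fixed-point algebra is AF. -/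
theorem isAFAlgebra_fixedAlgebra (hL : (∀ i, 0 < L i) ∨ (∀ i, L i < 0)) :
    IsAFAlgebra (fixedAlgebra L) := by
  rcases hL with hL | hL
  · exact isAFAlgebra_fixedAlgebra_of_pos L hL
  · have h := isAFAlgebra_fixedAlgebra_of_pos (-L) fun i => neg_pos.2 (hL i)
    exact isAFAlgebra_of_eq (fixedAlgebra_neg L) h

end CuntzAlgebra

/-! ### Fixed states of the transfer operator -/

section Transfer

variable {d : ℕ} {A : Type*} [CStarAlgebra A]

/-- The transfer operator `φ ↦ ∑ᵢ wᵢ φ(sᵢ* · sᵢ)` on linear functionals. -/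
noncomputable def transfer (s : Fin d → A) (w : Fin d → ℝ) (φ : A →ₗ[ℂ] ℂ) : A →ₗ[ℂ] ℂ :=
  ∑ i, (w i : ℂ) •
    (φ ∘ₗ LinearMap.mulRight ℂ (s i) ∘ₗ LinearMap.mulLeft ℂ (star (s i)))

theorem transfer_apply (s : Fin d → A) (w : Fin d → ℝ) (φ : A →ₗ[ℂ] ℂ) (a : A) :
    transfer s w φ a = ∑ i, (w i : ℂ) * φ (star (s i) * a * s i) := by
  simp [transfer, LinearMap.sum_apply]

/-- A state that is a contraction. -/
def IsContractiveState (φ : A →ₗ[ℂ] ℂ) : Prop := IsState φ ∧ ∀ a, ‖φ a‖ ≤ ‖a‖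

variable {s : Fin d → A} {w : Fin d → ℝ}

/-- Each φ(sᵢ* · sᵢ) is again a contractive state because sᵢ is an isometry, and the weights form a
convex combination. -/
theorem IsContractiveState.transfer [Nontrivial A] (hs : IsCuntzFamily s) (hw : ∀ i, 0 ≤ w i)
    (hw1 : ∑ i, w i = 1) {φ : A →ₗ[ℂ] ℂ} (hφ : IsContractiveState φ) :
    IsContractiveState (transfer s w φ) := by
  refine ⟨⟨fun x => ?_, ?_⟩, fun a => ?_⟩
  · rw [transfer_apply]
    refine Finset.sum_nonneg fun i _ => mul_nonneg (by exact_mod_cast hw i) ?_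
    have h := hφ.1.nonneg (x * s i)
    rwa [star_mul, mul_assoc, ← mul_assoc (star x), ← mul_assoc] at h
  · rw [transfer_apply]
    simp only [mul_one, hs.star_mul, if_true, hφ.1.map_one]
    exact_mod_cast hw1
  · rw [transfer_apply]
    have h : ∀ i, ‖(w i : ℂ) * φ (star (s i) * a * s i)‖ ≤ w i * ‖a‖ := by
      intro i
      rw [norm_mul, Complex.norm_real, Real.norm_of_nonneg (hw i)]
      refine mul_le_mul_of_nonneg_left ((hφ.2 _).trans ?_) (hw i)
      have h1 := hs.norm_le_one i
      calc ‖star (s i) * a * s i‖ ≤ ‖star (s i)‖ * ‖a‖ * ‖s i‖ :=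
            (norm_mul_le _ _).trans (mul_le_mul_of_nonneg_right (norm_mul_le _ _) (norm_nonneg _))
        _ ≤ 1 * ‖a‖ * 1 := by
            rw [norm_star]
            gcongr
        _ = ‖a‖ := by ring
    refine (norm_sum_le _ _).trans ((Finset.sum_le_sum fun i _ => h i).trans ?_)
    rw [← Finset.sum_mul, hw1, one_mul]

theorem IsContractiveState.average {φ : ℕ → A →ₗ[ℂ] ℂ} (hφ : ∀ k, IsContractiveState (φ k))
    (n : ℕ) :
    IsContractiveState (((n + 1 : ℝ)⁻¹ : ℂ) • ∑ k ∈ Finset.range (n + 1), φ k) := by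
  have hn : (0 : ℝ) < n + 1 := by positivity
  have hn0 : ((n : ℂ) + 1) ≠ 0 := by exact_mod_cast hn.ne'
  refine ⟨⟨fun x => ?_, ?_⟩, fun a => ?_⟩
  · rw [LinearMap.smul_apply, LinearMap.sum_apply, smul_eq_mul]
    refine mul_nonneg ?_ (Finset.sum_nonneg fun k _ => (hφ k).1.nonneg x)
    exact_mod_cast (inv_pos.2 hn).le
  · rw [LinearMap.smul_apply, LinearMap.sum_apply, Finset.sum_congr rfl fun k _ => (hφ k).1.map_one]
    simp [hn0]
  · rw [LinearMap.smul_apply, LinearMap.sum_apply, norm_smul]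
    have h : ‖∑ k ∈ Finset.range (n + 1), φ k a‖ ≤ (n + 1) * ‖a‖ := by
      refine (norm_sum_le _ _).trans ((Finset.sum_le_sum fun k _ => (hφ k).2 a).trans ?_)
      simp
    rw [norm_inv, Complex.norm_real, Real.norm_of_nonneg hn.le, inv_mul_le_iff₀ hn]
    exact h

/-- A sequence of contractive states converges pointwise along an ultrafilter to a state. -/
theorem exists_isState_tendsto {φ : ℕ → A →ₗ[ℂ] ℂ} (hφ : ∀ k, IsContractiveState (φ k))
    (U : Ultrafilter ℕ) :
    ∃ ψ : A →ₗ[ℂ] ℂ, IsState ψ ∧ ∀ a, Filter.Tendsto (fun n => φ n a) U (nhds (ψ a)) := by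
  have h : ∀ a, ∃ z, Filter.Tendsto (fun n => φ n a) U (nhds z) := by
    intro a
    obtain ⟨z, -, hz⟩ := (isCompact_closedBall (0 : ℂ) ‖a‖).ultrafilter_le_nhds'
      (U.map fun n => φ n a)
      (Filter.mem_map.2 (Filter.univ_mem' fun n => by simpa using (hφ n).2 a))
    exact ⟨z, hz⟩
  choose f hf using h
  refine ⟨{ toFun := f, map_add' := fun a b => ?_, map_smul' := fun c a => ?_ },
    ⟨fun x => ?_, ?_⟩, hf⟩
  · refine tendsto_nhds_unique (hf (a + b)) ?_
    simpa only [map_add] using (hf a).add (hf b)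
  · refine tendsto_nhds_unique (hf (c • a)) ?_
    simpa only [map_smul, RingHom.id_apply] using (hf a).const_smul c
  · exact ge_of_tendsto' (hf _) fun n => (hφ n).1.nonneg x
  · refine tendsto_nhds_unique (hf 1) ?_
    simpa only [(hφ _).1.map_one] using tendsto_const_nhds

/-- The transfer operator has a fixed state, by averaging. -/
theorem exists_isState_transfer_eq [Nontrivial A] (hs : IsCuntzFamily s) (hw : ∀ i, 0 ≤ w i)
    (hw1 : ∑ i, w i = 1) {φ : A →ₗ[ℂ] ℂ} (hφ : IsContractiveState φ) :
    ∃ ψ : A →ₗ[ℂ] ℂ, IsState ψ ∧ transfer s w ψ = ψ := by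
  let χ : ℕ → A →ₗ[ℂ] ℂ := fun k => (transfer s w)^[k] φ
  have hχ : ∀ k, IsContractiveState (χ k) := by
    intro k
    induction k with
    | zero => exact hφ
    | succ k ih =>
      change IsContractiveState ((transfer s w)^[k + 1] φ)
      rw [Function.iterate_succ_apply']
      exact ih.transfer hs hw hw1
  let ρ : ℕ → A →ₗ[ℂ] ℂ :=
    fun n => ((n + 1 : ℝ)⁻¹ : ℂ) • ∑ k ∈ Finset.range (n + 1), χ k
  have hρ : ∀ n, IsContractiveState (ρ n) := IsContractiveState.average hχ
  let U : Ultrafilter ℕ := Filter.hyperfilter ℕ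
  have hU : (U : Filter ℕ) ≤ Filter.atTop := Nat.hyperfilter_le_atTop
  obtain ⟨ψ, hψ, hlim⟩ := exists_isState_tendsto hρ U
  refine ⟨ψ, hψ, LinearMap.ext fun a => ?_⟩
  have h1 : Filter.Tendsto (fun n => transfer s w (ρ n) a) U (nhds (transfer s w ψ a)) := by
    simp only [transfer_apply]
    exact tendsto_finsetSum _ fun i _ => (hlim _).const_mul _
  -- The sum telescopes, leaving two bounded terms divided by n + 1; every limit of the averages is
  -- therefore fixed.
  have h2 : ∀ n, transfer s w (ρ n) a - ρ n a =
      ((n + 1 : ℝ)⁻¹ : ℂ) * (χ (n + 1) a - χ 0 a) := by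
    intro n
    have h3 : transfer s w (ρ n) a =
        ((n + 1 : ℝ)⁻¹ : ℂ) * ∑ k ∈ Finset.range (n + 1), χ (k + 1) a := by
      have h4 : ∀ k, χ (k + 1) a = ∑ i, (w i : ℂ) * χ k (star (s i) * a * s i) := fun k => by
        rw [← transfer_apply]
        change (transfer s w)^[k + 1] φ a = _
        rw [Function.iterate_succ_apply']
      rw [transfer_apply, Finset.sum_congr rfl fun k _ => h4 k, Finset.sum_comm, Finset.mul_sum]
      refine Finset.sum_congr rfl fun i _ => ?_
      simp only [ρ, LinearMap.smul_apply, LinearMap.sum_apply, smul_eq_mul, ← Finset.mul_sum]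
      ring
    rw [h3]
    simp only [ρ, LinearMap.smul_apply, LinearMap.sum_apply, smul_eq_mul]
    rw [← mul_sub, ← Finset.sum_sub_distrib, Finset.sum_range_sub (fun k => χ k a)]
  have h5 : Filter.Tendsto (fun n => transfer s w (ρ n) a - ρ n a) Filter.atTop (nhds 0) := by
    rw [tendsto_zero_iff_norm_tendsto_zero]
    refine squeeze_zero (fun _ => norm_nonneg _) (g := fun n : ℕ => 1 / ((n : ℝ) + 1) * (2 * ‖a‖))
      (fun n => ?_) ?_
    · have hn : (0 : ℝ) < n + 1 := by positivity
      rw [h2, norm_mul, norm_inv, Complex.norm_real, Real.norm_of_nonneg hn.le, one_div]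
      refine mul_le_mul_of_nonneg_left ?_ (inv_pos.2 hn).le
      refine (norm_sub_le _ _).trans ?_
      linarith [(hχ (n + 1)).2 a, (hχ 0).2 a]
    · simpa using (tendsto_one_div_add_atTop_nhds_zero_nat (𝕜 := ℝ)).mul_const (2 * ‖a‖)
  have h6 := tendsto_nhds_unique (h1.sub (hlim a)) (h5.mono_left hU)
  exact sub_eq_zero.1 h6

/-- Expanding φ once by its fixed-point equation, sᵢ* sⱼ = δᵢⱼ keeps a single term. For w = e^{-βL}
this is the KMS condition at sⱼ. -/
theorem apply_gen_mul_of_transfer_eq (hs : IsCuntzFamily s) {φ : A →ₗ[ℂ] ℂ}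
    (hφ : transfer s w φ = φ) (j : Fin d) (a : A) : φ (s j * a) = w j * φ (a * s j) := by
  rw [← hφ, transfer_apply, hφ, Finset.sum_eq_single j]
  · rw [← mul_assoc, hs.star_mul, if_pos rfl, one_mul]
  · intro i _ hij
    rw [← mul_assoc, hs.star_mul, if_neg hij, zero_mul, zero_mul, map_zero, mul_zero]
  · simp

theorem apply_mul_star_gen_of_transfer_eq (hs : IsCuntzFamily s) {φ : A →ₗ[ℂ] ℂ}
    (hφ : transfer s w φ = φ) (j : Fin d) (a : A) :
    φ (a * star (s j)) = w j * φ (star (s j) * a) := by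
  rw [← hφ, transfer_apply, hφ, Finset.sum_eq_single j]
  · rw [mul_assoc, mul_assoc a, hs.star_mul, if_pos rfl, mul_one]
  · intro i _ hij
    rw [mul_assoc, mul_assoc a, hs.star_mul, if_neg hij.symm, mul_zero, mul_zero, map_zero,
      mul_zero]
  · simp

end Transfer

/-! ### Solving ∑ e^{-βLᵢ} = 1 and constructing a KMS state -/

/-- For positive `Lᵢ`, the equation `∑ᵢ e^{-βLᵢ} = 1` has a solution. -/
theorem exists_sum_exp_eq_one_of_pos {d : ℕ} (hd : 2 ≤ d) {L : Fin d → ℤ} (hL : ∀ i, 0 < L i) :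
    ∃ β : ℝ, ∑ i, Real.exp (-β * L i) = 1 := by
  have hd' : (0 : ℝ) < d := by exact_mod_cast (by omega : 0 < d)
  have hlog : 0 ≤ Real.log d := Real.log_natCast_nonneg d
  have hcont : ContinuousOn (fun β : ℝ => ∑ i, Real.exp (-β * L i)) (Set.Icc 0 (Real.log d)) := by
    fun_prop
  -- At β = 0 the sum is d; at β = log d each term is at most 1/d, as Lᵢ ≥ 1.
  have h := intermediate_value_Icc' hlog hcont
  obtain ⟨β, -, hβ⟩ := h (show (1 : ℝ) ∈ _ from ⟨by
    have h1 : ∀ i, Real.exp (-Real.log d * L i) ≤ (d : ℝ)⁻¹ := by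
      intro i
      have h2 : (1 : ℝ) ≤ L i := by exact_mod_cast hL i
      rw [← Real.exp_log hd', ← Real.exp_neg, Real.exp_log hd']
      refine Real.exp_le_exp.2 ?_
      nlinarith
    refine (Finset.sum_le_sum fun i _ => h1 i).trans ?_
    simp [mul_inv_cancel₀ hd'.ne'], by
    simp only [neg_zero, zero_mul, Real.exp_zero, Finset.sum_const, Finset.card_univ,
      Fintype.card_fin, nsmul_eq_mul, mul_one]
    exact_mod_cast (by omega : 1 ≤ d)⟩)
  exact ⟨β, hβ⟩

theorem exists_sum_exp_eq_one {d : ℕ} (hd : 2 ≤ d) {L : Fin d → ℤ}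
    (hL : (∀ i, 0 < L i) ∨ (∀ i, L i < 0)) : ∃ β : ℝ, ∑ i, Real.exp (-β * L i) = 1 := by
  rcases hL with hL | hL
  · exact exists_sum_exp_eq_one_of_pos hd hL
  · obtain ⟨β, hβ⟩ := exists_sum_exp_eq_one_of_pos hd (L := -L) fun i => neg_pos.2 (hL i)
    refine ⟨-β, ?_⟩
    rw [← hβ]
    refine Finset.sum_congr rfl fun i _ => ?_
    congr 1
    simp

namespace CuntzAlgebra

variable {d : ℕ} (L : Fin d → ℤ)

theorem exists_isContractiveState (hd : 2 ≤ d) :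
    ∃ φ : CuntzAlgebra d →ₗ[ℂ] ℂ, IsContractiveState φ := by
  obtain ⟨π⟩ := nonempty_representation hd
  let ξ : lp (fun _ : ℕ => ℂ) 2 := lp.single 2 0 1
  have hξ : ‖ξ‖ = 1 := by
    have h := lp.norm_single (E := fun _ : ℕ => ℂ) (p := 2) (by norm_num) 0 1
    exact h.trans (by simp)
  refine ⟨(innerSL ℂ ξ).toLinearMap ∘ₗ
    (ContinuousLinearMap.apply ℂ (lp (fun _ : ℕ => ℂ) 2) ξ).toLinearMap ∘ₗ
      π.toAlgHom.toLinearMap, ⟨fun x => ?_, ?_⟩, fun a => ?_⟩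
  · change 0 ≤ inner ℂ ξ (π (star x * x) ξ)
    have h : inner ℂ ξ (π (star x * x) ξ) = inner ℂ (π x ξ) (π x ξ) := by
      rw [map_mul, map_star, ContinuousLinearMap.star_eq_adjoint]
      exact ContinuousLinearMap.adjoint_inner_right (π x) ξ (π x ξ)
    rw [h, inner_self_eq_norm_sq_to_K]
    positivity
  · change inner ℂ ξ (π 1 ξ) = 1
    rw [map_one]
    change inner ℂ ξ ξ = 1
    rw [inner_self_eq_norm_sq_to_K, hξ]
    simp
  · change ‖inner ℂ ξ (π a ξ)‖ ≤ ‖a‖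
    refine (norm_inner_le_norm _ _).trans ?_
    rw [hξ, one_mul]
    refine ((π a).le_opNorm ξ).trans ?_
    rw [hξ, mul_one]
    exact NonUnitalStarAlgHom.norm_apply_le π a

theorem sigma_mem_adjoin_gen (t : ℝ) {x : CuntzAlgebra d}
    (hx : x ∈ StarAlgebra.adjoin ℂ (Set.range (gen d))) :
    sigma L t x ∈ StarAlgebra.adjoin ℂ (Set.range (gen d)) := by
  have h : StarAlgebra.adjoin ℂ (Set.range (gen d)) ≤
      (StarAlgebra.adjoin ℂ (Set.range (gen d))).comap
        ((sigma L t : CuntzAlgebra d ≃⋆ₐ[ℂ] CuntzAlgebra d) :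
          CuntzAlgebra d →⋆ₐ[ℂ] CuntzAlgebra d) := by
    refine StarAlgebra.adjoin_le ?_
    rintro _ ⟨i, rfl⟩
    change sigma L t (gen d i) ∈ StarAlgebra.adjoin ℂ (Set.range (gen d))
    rw [sigma_gen]
    exact SMulMemClass.smul_mem _ (StarAlgebra.subset_adjoin ℂ _ ⟨i, rfl⟩)
  exact h hx

theorem isEntireOrbit_gen (j : Fin d) : IsEntireOrbit (sigma L) (gen d j)
    fun z => Complex.exp (Complex.I * z * L j) • gen d j :=
  ⟨by fun_prop, fun t => (sigma_gen L t j).symm⟩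

theorem isEntireOrbit_star_gen (j : Fin d) : IsEntireOrbit (sigma L) (star (gen d j))
    fun z => Complex.exp (-(Complex.I * z * L j)) • star (gen d j) := by
  refine ⟨by fun_prop, fun t => ?_⟩
  rw [map_star, sigma_gen, star_smul, Complex.star_def, ← Complex.exp_conj]
  simp

/-- A solution of `∑ᵢ e^{-βLᵢ} = 1` gives a KMS state. -/
theorem exists_isKMSState (hd : 2 ≤ d) {β : ℝ} (hβ : ∑ i, Real.exp (-β * L i) = 1) :
    ∃ ω : CuntzAlgebra d →ₗ[ℂ] ℂ, IsKMSState (sigma L) β ω := by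
  have := nontrivial hd
  have hs := isCuntzFamily_gen d
  obtain ⟨φ, hφ⟩ := exists_isContractiveState hd
  obtain ⟨ω, hω, hfix⟩ := exists_isState_transfer_eq hs (fun i => (Real.exp_pos _).le) hβ hφ
  refine ⟨ω, hω, (StarAlgebra.adjoin ℂ (Set.range (gen d))).toNonUnitalStarSubalgebra,
    dense_adjoin_gen d, fun t x hx => sigma_mem_adjoin_gen L t hx, fun y hy => ?_⟩
  -- The identity is proved for all x, since the product step applies it to x f(iβ) in place of x.
  suffices h : ∃ f : ℂ → CuntzAlgebra d, IsEntireOrbit (sigma L) y f ∧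
      ∀ x, ω (x * f (Complex.I * β)) = ω (y * x) by
    obtain ⟨f, hf, h⟩ := h
    exact ⟨f, hf, fun x _ => h x⟩
  have hexp : ∀ j, Complex.I * (Complex.I * β) * L j = ((-β * L j : ℝ) : ℂ) := fun j => by
    push_cast
    linear_combination (β : ℂ) * L j * Complex.I_mul_I
  replace hy : y ∈ Algebra.adjoin ℂ (Set.range (gen d) ∪ star (Set.range (gen d))) := hy
  induction hy using Algebra.adjoin_induction with
  | mem y hy =>
    rcases hy with ⟨j, rfl⟩ | ⟨j, hj⟩
    · refine ⟨_, isEntireOrbit_gen L j, fun x => ?_⟩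
      rw [hexp, ← Complex.ofReal_exp, mul_smul_comm, map_smul, smul_eq_mul,
        apply_gen_mul_of_transfer_eq hs hfix]
    · obtain rfl : y = star (gen d j) := by rw [hj, star_star]
      refine ⟨_, isEntireOrbit_star_gen L j, fun x => ?_⟩
      rw [hexp, Complex.exp_neg, ← Complex.ofReal_exp, mul_smul_comm, map_smul, smul_eq_mul,
        apply_mul_star_gen_of_transfer_eq hs hfix, inv_mul_cancel_left₀]
      exact_mod_cast (Real.exp_pos _).ne'
  | algebraMap r =>
    refine ⟨fun _ => algebraMap ℂ _ r, ⟨by fun_prop, fun t => ?_⟩, fun x => ?_⟩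
    · rw [Algebra.algebraMap_eq_smul_one, map_smul, map_one]
    · rw [Algebra.commutes]
  | add y z _ _ hy hz =>
    obtain ⟨f, hf, hy⟩ := hy
    obtain ⟨g, hg, hz⟩ := hz
    refine ⟨fun z => f z + g z, ⟨hf.1.add hg.1, fun t => ?_⟩, fun x => ?_⟩
    · simp only [hf.2, hg.2, map_add]
    · rw [mul_add, map_add, hy, hz, add_mul, map_add]
  | mul y z _ _ hy hz =>
    obtain ⟨f, hf, hy⟩ := hy
    obtain ⟨g, hg, hz⟩ := hz
    refine ⟨fun z => f z * g z, ⟨hf.1.mul hg.1, fun t => ?_⟩, fun x => ?_⟩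
    · simp only [hf.2, hg.2, map_mul]
    · rw [← mul_assoc, hz, ← mul_assoc, hy, mul_assoc]

end CuntzAlgebra

/-! ### The KMS condition on eigenvectors -/

/-- A state is continuous. -/
theorem IsState.continuous {A : Type*} [CStarAlgebra A] {ω : A →ₗ[ℂ] ℂ} (hω : IsState ω) :
    Continuous ω := by
  let _ := CStarAlgebra.spectralOrder A
  let _ := CStarAlgebra.spectralOrderedRing A
  let f : A →ₚ[ℂ] ℂ := PositiveLinearMap.mk₀ ω fun a ha => by
    obtain ⟨b, rfl⟩ := CStarAlgebra.nonneg_iff_eq_star_mul_self.1 ha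
    exact hω.nonneg b
  exact map_continuous f

section EntireOrbit

variable {A : Type*} [CStarAlgebra A]

/-- Entire functions that agree on the real line are equal. -/
theorem Differentiable.eq_of_forall_ofReal {f g : ℂ → A} (hf : Differentiable ℂ f)
    (hg : Differentiable ℂ g) (h : ∀ t : ℝ, f t = g t) : f = g := by
  refine AnalyticOnNhd.eq_of_frequently_eq (z₀ := 0) (fun z _ => hf.analyticAt z)
    (fun z _ => hg.analyticAt z) ?_
  have h1 : Filter.Tendsto (fun n : ℕ => (((1 / ((n : ℝ) + 1)) : ℝ) : ℂ)) Filter.atTop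
      (nhdsWithin 0 {0}ᶜ) := by
    refine tendsto_nhdsWithin_iff.2 ⟨?_, Filter.Eventually.of_forall fun n => ?_⟩
    · have := (Complex.continuous_ofReal.tendsto 0).comp
        (tendsto_one_div_add_atTop_nhds_zero_nat (𝕜 := ℝ))
      rwa [Complex.ofReal_zero] at this
    · have hn : (1 / ((n : ℝ) + 1)) ≠ 0 := by positivity
      simp only [Set.mem_compl_iff, Set.mem_singleton_iff]
      exact_mod_cast hn
  exact h1.frequently (Filter.Frequently.of_forall fun n => h _)

variable {σ : ℝ → A ≃⋆ₐ[ℂ] A} {y : A} {f : ℂ → A}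

theorem IsEntireOrbit.unique {g : ℂ → A} (hf : IsEntireOrbit σ y f) (hg : IsEntireOrbit σ y g) :
    f = g :=
  hf.1.eq_of_forall_ofReal hg.1 fun t => by rw [hf.2, hg.2]

theorem IsEntireOrbit.comp_add (hσ : ∀ t u, σ (t + u) = σ t * σ u) (hf : IsEntireOrbit σ y f)
    (t : ℝ) : IsEntireOrbit σ (σ t y) fun z => f (z + t) := by
  refine ⟨hf.1.comp (by fun_prop), fun u => ?_⟩
  have h := hf.2 (u + t)
  rw [Complex.ofReal_add] at h
  rw [hσ] at h
  exact h

/-- The integral of an entire function with real period over a period does not depend on the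
horizontal line. -/
theorem integral_add_mul_I_eq {g : ℂ → A} (hg : Differentiable ℂ g) {T : ℝ}
    (hT : ∀ z, g (z + T) = g z) (β : ℝ) :
    ∫ t in (0 : ℝ)..T, g (t + β * Complex.I) = ∫ t in (0 : ℝ)..T, g t := by
  have h := Complex.integral_boundary_rect_eq_zero_of_differentiableOn g 0 (T + β * Complex.I)
    hg.differentiableOn
  -- By periodicity the vertical sides of the rectangle cancel in Cauchy's theorem.
  have h1 : ∀ u : ℝ, g (T + u * Complex.I) = g (u * Complex.I) := fun u => by
    rw [add_comm, hT]
  simp only [Complex.zero_re, Complex.zero_im, Complex.add_re, Complex.ofReal_re, Complex.mul_re,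
    Complex.I_re, mul_zero, Complex.ofReal_im, Complex.I_im, mul_one, sub_self, add_zero,
    Complex.add_im, Complex.mul_im, zero_add, Complex.ofReal_zero, zero_mul, h1] at h
  rw [add_sub_cancel_right] at h
  exact (sub_eq_zero.1 h).symm

/-- The KMS condition holds for all `x`, along the whole horizontal line. -/
theorem IsKMSState.exists_dense (hσ : ∀ t u, σ (t + u) = σ t * σ u) {β : ℝ} {ω : A →ₗ[ℂ] ℂ}
    (hω : IsKMSState σ β ω) :
    Dense {y : A | ∃ f : ℂ → A, IsEntireOrbit σ y f ∧
      ∀ (t : ℝ) (x : A), ω (x * f (t + β * Complex.I)) = ω (σ t y * x)} := by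
  obtain ⟨hstate, B, hB, hinv, hkms⟩ := hω
  have hc := hstate.continuous
  refine hB.mono fun y hy => ?_
  obtain ⟨f, hf, -⟩ := hkms y hy
  refine ⟨f, hf, fun t => ?_⟩
  -- The orbit of σ_t(y) extends uniquely, namely to the translate of f, so its KMS identity
  -- concerns f at t + iβ. Continuity of ω then frees x from `B`.
  obtain ⟨g, hg, h⟩ := hkms (σ t y) (hinv t y hy)
  obtain rfl := hg.unique (hf.comp_add hσ t)
  have h1 : (fun x => ω (x * f (t + β * Complex.I))) = fun x => ω (σ t y * x) := by
    refine Continuous.ext_on hB (by fun_prop) (by fun_prop) fun x hx => ?_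
    have := h x hx
    simp only at this
    rwa [mul_comm Complex.I, add_comm] at this
  exact fun x => congrFun h1 x

/-- A KMS state of a `2π`-periodic one-parameter group satisfies the KMS condition for the
eigenvectors of the group. -/
theorem IsKMSState.apply_eigenvector (hσ : ∀ t u, σ (t + u) = σ t * σ u)
    (hper : σ (2 * Real.pi) = 1) (hnorm : ∀ t x, ‖σ t x‖ = ‖x‖) {β : ℝ} {ω : A →ₗ[ℂ] ℂ}
    (hω : IsKMSState σ β ω) {s : A} {k : ℤ}
    (hs : ∀ t : ℝ, σ t s = Complex.exp (Complex.I * t * k) • s) (x : A) :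
    ω (x * s) = Complex.exp (k * β) * ω (s * x) := by
  have hc := hω.1.continuous
  have hclosed : IsClosed {a : A | ω (x * a) = Complex.exp (k * β) * ω (a * x)} :=
    isClosed_eq (by fun_prop) (by fun_prop)
  suffices h : s ∈ closure {a : A | ω (x * a) = Complex.exp (k * β) * ω (a * x)} from
    hclosed.closure_subset h
  rw [Metric.mem_closure_iff]
  intro ε hε
  obtain ⟨y, ⟨f, hf, hkms⟩, hy⟩ := Metric.mem_closure_iff.1 (hω.exists_dense hσ s) ε hε
  have hpi : (0 : ℝ) < 2 * Real.pi := by positivity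
  -- The mean of e^{-ikt} σ_t(y) over a period is the k-th Fourier component of y. It will satisfy
  -- the identity exactly and still approximate s.
  let g : ℂ → A := fun z => Complex.exp (-(Complex.I * z * k)) • f z
  have hg : Differentiable ℂ g := by
    have := hf.1
    fun_prop
  have hfper : ∀ z, f (z + (2 * Real.pi : ℝ)) = f z := by
    have h1 := hf.comp_add hσ (2 * Real.pi)
    rw [hper] at h1
    exact fun z => congrFun (h1.unique hf) z
  have hgper : ∀ z, g (z + (2 * Real.pi : ℝ)) = g z := by
    intro z
    simp only [g]
    rw [hfper]
    congr 1
    rw [Complex.exp_eq_exp_iff_exists_int]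
    refine ⟨-k, ?_⟩
    push_cast
    ring
  have hgc : Continuous g := hg.continuous
  have hi1 : IntervalIntegrable (fun t : ℝ => g t) MeasureTheory.volume 0 (2 * Real.pi) :=
    (hgc.comp Complex.continuous_ofReal).intervalIntegrable _ _
  have hi2 : IntervalIntegrable (fun t : ℝ => g (t + β * Complex.I)) MeasureTheory.volume 0
      (2 * Real.pi) :=
    (hgc.comp (by fun_prop : Continuous fun t : ℝ =>
      (t : ℂ) + β * Complex.I)).intervalIntegrable _ _
  let Y : A := ∫ t in (0 : ℝ)..(2 * Real.pi), g t
  let ω' : A →L[ℂ] ℂ := ⟨ω, hc⟩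
  have hYl : ω (x * Y) = ∫ t in (0 : ℝ)..(2 * Real.pi), ω (x * g (t + β * Complex.I)) := by
    have h := (ω'.comp (ContinuousLinearMap.mul ℂ A x)).intervalIntegral_comp_comm hi2
    rw [integral_add_mul_I_eq hg hgper β] at h
    exact h.symm
  have hYr : ω (Y * x) = ∫ t in (0 : ℝ)..(2 * Real.pi), ω (g t * x) :=
    ((ω'.comp ((ContinuousLinearMap.mul ℂ A).flip x)).intervalIntegral_comp_comm hi1).symm
  -- On the left the contour is moved to height β, where the KMS condition applies; the factor
  -- e^{-ik(t+iβ)} = e^{kβ} e^{-ikt} supplies the constant.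
  have hY : ω (x * Y) = Complex.exp (k * β) * ω (Y * x) := by
    rw [hYl, hYr, ← intervalIntegral.integral_const_mul]
    refine intervalIntegral.integral_congr fun t _ => ?_
    simp only [g]
    rw [mul_smul_comm, map_smul, hkms, hf.2, smul_mul_assoc, map_smul, smul_eq_mul, smul_eq_mul,
      ← mul_assoc, ← Complex.exp_add]
    congr 2
    linear_combination -(k : ℂ) * β * Complex.I_mul_I
  have hdist : ‖Y - ((2 * Real.pi : ℝ) : ℂ) • s‖ ≤ ‖y - s‖ * |2 * Real.pi - 0| := by
    have hconst : ((2 * Real.pi : ℝ) : ℂ) • s = ∫ _ in (0 : ℝ)..(2 * Real.pi), s := by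
      rw [intervalIntegral.integral_const, sub_zero, Complex.coe_smul]
    rw [hconst, ← intervalIntegral.integral_sub hi1 (intervalIntegrable_const)]
    refine intervalIntegral.norm_integral_le_of_norm_le_const fun t _ => ?_
    -- The isometry e^{-ikt} σ_t fixes s, so g(t) stays as close to s as y is.
    have h1 : g t - s = Complex.exp (-(Complex.I * t * k)) • σ t (y - s) := by
      simp only [g]
      rw [hf.2, map_sub, hs, smul_sub, smul_smul, ← Complex.exp_add, neg_add_cancel,
        Complex.exp_zero, one_smul]
    have h2 : ‖Complex.exp (-(Complex.I * t * k))‖ = 1 := by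
      rw [Complex.norm_exp]
      simp
    rw [h1, norm_smul, hnorm, h2, one_mul]
  have hpi' : ((2 * Real.pi : ℝ) : ℂ) ≠ 0 := by exact_mod_cast hpi.ne'
  refine ⟨((2 * Real.pi : ℝ) : ℂ)⁻¹ • Y, ?_, ?_⟩
  · simp only [Set.mem_ofPred_eq]
    rw [mul_smul_comm, smul_mul_assoc, map_smul, map_smul, hY, smul_eq_mul, smul_eq_mul]
    ring
  · rw [dist_comm, dist_eq_norm] at hy ⊢
    have h3 : ((2 * Real.pi : ℝ) : ℂ)⁻¹ • Y - s =
        ((2 * Real.pi : ℝ) : ℂ)⁻¹ • (Y - ((2 * Real.pi : ℝ) : ℂ) • s) := by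
      rw [smul_sub, inv_smul_smul₀ hpi']
    rw [h3, norm_smul, norm_inv, Complex.norm_real, Real.norm_of_nonneg hpi.le,
      inv_mul_lt_iff₀ hpi]
    refine hdist.trans_lt ?_
    rw [sub_zero, abs_of_pos hpi, mul_comm]
    exact mul_lt_mul_of_pos_left hy hpi

end EntireOrbit

/-! ### From KMS states to equal strict signs -/

namespace CuntzAlgebra

variable {d : ℕ} (L : Fin d → ℤ)

theorem sigma_two_pi : sigma L (2 * Real.pi) = 1 := by
  have h : (fun j => Circle.exp (2 * Real.pi * L j)) = (1 : Fin d → Circle) := by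
    funext j
    rw [mul_comm]
    exact Circle.exp_int_mul_two_pi (L j)
  ext1 x
  change gaugeHom (fun j => Circle.exp (2 * Real.pi * L j)) x = x
  rw [h, gaugeHom_one]
  rfl

theorem sum_exp_eq_one_of_isKMSState {β : ℝ} {ω : CuntzAlgebra d →ₗ[ℂ] ℂ}
    (hω : IsKMSState (sigma L) β ω) : ∑ i, Real.exp (-(β * L i)) = 1 := by
  have hs := isCuntzFamily_gen d
  have h : ∀ i, ω (gen d i * star (gen d i)) = (Real.exp (-(β * L i)) : ℝ) := by
    intro i
    have h1 := hω.apply_eigenvector (sigma_add L) (sigma_two_pi L) (norm_sigma L)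
      (fun t => sigma_gen L t i) (star (gen d i))
    rw [hs.star_mul, if_pos rfl, hω.1.map_one] at h1
    rw [eq_comm, mul_comm] at h1
    rw [eq_div_of_mul_eq (Complex.exp_ne_zero _) h1, one_div, ← Complex.exp_neg]
    push_cast
    rw [mul_comm]
  have h2 := hω.1.map_one
  rw [← hs.sum_mul_star, map_sum, Finset.sum_congr rfl fun i _ => h i] at h2
  exact_mod_cast h2

/-- If there is a KMS state, then the `Lᵢ` have the same strict sign. -/
theorem same_sign_of_isKMSState (hd : 2 ≤ d) {β : ℝ} {ω : CuntzAlgebra d →ₗ[ℂ] ℂ}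
    (hω : IsKMSState (sigma L) β ω) : (∀ i, 0 < L i) ∨ (∀ i, L i < 0) := by
  have hsum := sum_exp_eq_one_of_isKMSState L hω
  -- As d ≥ 2, each positive term is strictly below the total 1, so its exponent is negative.
  have hpos : ∀ i, 0 < β * L i := by
    intro i
    have : Nontrivial (Fin d) := Fin.nontrivial_iff_two_le.2 hd
    obtain ⟨j, hj⟩ := exists_ne i
    have h1 : Real.exp (-(β * L i)) < ∑ i, Real.exp (-(β * L i)) :=
      Finset.single_lt_sum (f := fun i => Real.exp (-(β * L i))) hj
        (Finset.mem_univ i) (Finset.mem_univ j) (Real.exp_pos _)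
        fun k _ _ => (Real.exp_pos _).le
    rw [hsum, Real.exp_lt_one_iff] at h1
    linarith
  rcases lt_trichotomy β 0 with hβ | rfl | hβ
  · refine Or.inr fun i => ?_
    have := neg_of_mul_pos_right (hpos i) hβ.le
    exact_mod_cast this
  · have := hpos ⟨0, by omega⟩
    simp at this
  · refine Or.inl fun i => ?_
    have := (mul_pos_iff_of_pos_left hβ).1 (hpos i)
    exact_mod_cast this

end CuntzAlgebra

theorem mainTheorem6 (d : ℕ) (hd : 2 ≤ d) (L : Fin d → ℤ) :
    List.TFAE [
      IsAFAlgebra (CuntzAlgebra.fixedAlgebra L),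
      (∀ i, 0 < L i) ∨ (∀ i, L i < 0),
      ∃ (β : ℝ) (ω : CuntzAlgebra d →ₗ[ℂ] ℂ), IsKMSState (CuntzAlgebra.sigma L) β ω] ∧
    (¬ ((∀ i, 0 < L i) ∨ (∀ i, L i < 0)) →
      ∃ v : CuntzAlgebra.fixedAlgebra L, star v * v = 1 ∧ v ∉ unitary (CuntzAlgebra.fixedAlgebra L)) := by
  refine ⟨?_, CuntzAlgebra.exists_isometry_notMem_unitary L hd⟩
  tfae_have 1 → 2 := by
    intro hAF
    by_contra hL
    obtain ⟨v, hv, hvu⟩ := CuntzAlgebra.exists_isometry_notMem_unitary L hd hL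
    exact hvu (hAF.mem_unitary hv)
  tfae_have 2 → 1 := CuntzAlgebra.isAFAlgebra_fixedAlgebra L
  tfae_have 2 → 3 := by
    intro hL
    obtain ⟨β, hβ⟩ := exists_sum_exp_eq_one hd hL
    exact ⟨β, CuntzAlgebra.exists_isKMSState L hd hβ⟩
  tfae_have 3 → 2 := by
    rintro ⟨β, ω, hω⟩
    exact CuntzAlgebra.same_sign_of_isKMSState L hd hω
  tfae_finish
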